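/- **Theorem 3.1.** For an interval $(a,b)$ let $L^2(a,b)$ be the complex Lebesgue space and let $H^1(a,b)$, $H^2(a,b)$ be the complex Sobolev spaces (defined by weak derivatives); functions in $H^1(a,b)$ are identified with their continuous representatives on $[a,b]$. Let $$X=\{(u,v,w,\tilde u,\tilde v)\in H^1(0,1)\times L^2(0,1)\times L^2(1,2)\times H^1(2,3)\times L^2(2,3): u(0)=\tilde u(3)=0\}$$ with the norm $$\|(u,v,w,\tilde u,\tilde v)\|_X^2=\|u'\|_{L^2}^2+\|v\|_{L^2}^2+\|w\|_{L^2}^2+\|\tilde u'\|_{L^2}^2+\|\tilde v\|_{L^2}^2 ,$$ and let $A$ be the operator on $X$ (the generator of the one-dimensional wave–heat–wave system) given by $$A(u,v,w,\tilde u,\tilde v)=(v,u'',w'',\tilde v,\tilde u'')$$ whose domain $D(A)$ consists of all $(u,v,w,\tilde u,\tilde v)\in X$ with $u\in H^2(0,1)$, $v\in H^1(0,1)$, $w\in H^2(1,2)$, $\tilde u\in H^2(2,3)$, $\tilde v\in H^1(2,3)$ and $$v(0)=\tilde v(3)=0,\quad u'(1)=w'(1),\quad v(1)=w(1),\quad \tilde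 u'(2)=w'(2),\quad \tilde v(2)=w(2).$$ Then every $is$ with $s\in\mathbb R$ belongs to the resolvent set of $A$, and the resolvent $R(is,A)=(is-A)^{-1}$ satisfies $$\|R(is,A)\|=O(|s|^{1/2})\qquad (|s|\to\infty),$$ that is, there are constants $C,s_0>0$ such that $\|R(is,A)\|\le C|s|^{1/2}$ for all $s\in\mathbb R$ with $|s|\ge s_0$; here the norm is the operator norm on $X$. -/

import Mathlib

namespace WHW

noncomputable section

open MeasureTheory Set
open scoped ContDiff InnerProductSpace

/-! ## Sobolev functions on a bounded interval -/

/-- The complex Lebesgue space `L²(a,b)`. -/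
abbrev L2 (a b : ℝ) : Type := Lp ℂ 2 (volume.restrict (Ioo a b))

/-- `g` is the weak derivative of `f` on `(a,b)`: `∫ φ' f = - ∫ φ g` for every smooth `φ` with
compact support contained in `(a,b)`. -/
def IsWeakDeriv {a b : ℝ} (f g : L2 a b) : Prop :=
  ∀ φ : ℝ → ℝ, ContDiff ℝ ∞ φ → HasCompactSupport φ → tsupport φ ⊆ Ioo a b →
    ∫ x in Ioo a b, deriv φ x • f x = - ∫ x in Ioo a b, φ x • g x

/-- `f ∈ H¹(a,b)`: `f` is an `L²` function with a weak derivative in `L²`. -/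
def MemH1 {a b : ℝ} (f : L2 a b) : Prop := ∃ g : L2 a b, IsWeakDeriv f g

open Classical in
/-- The weak derivative of `f ∈ H¹(a,b)` (and `0` for `f ∉ H¹(a,b)`). -/
def wderiv {a b : ℝ} (f : L2 a b) : L2 a b :=
  if h : MemH1 f then h.choose else 0

/-- `f ∈ H²(a,b)`: `f` and its weak derivative both belong to `H¹(a,b)`. -/
def MemH2 {a b : ℝ} (f : L2 a b) : Prop := MemH1 f ∧ MemH1 (wderiv f)

/-- The continuous representative of `f` on `[a,b]` takes the value `y` at the point `c`. -/
def HasValue {a b : ℝ} (f : L2 a b) (c : ℝ) (y : ℂ) : Prop :=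
  ∃ F : ℝ → ℂ, ContinuousOn F (Icc a b) ∧ (f =ᵐ[volume.restrict (Ioo a b)] F) ∧ F c = y

/-! ### Uniqueness and linearity of the weak derivative -/

section basic

variable {a b : ℝ}

lemma integrable_L2 (f : L2 a b) : IntegrableOn f (Ioo a b) := by
  have : IsFiniteMeasure (volume.restrict (Ioo a b)) := ⟨by simp⟩
  exact (Lp.memLp f).integrable (by norm_num)

lemma integrable_smul_L2 (f : L2 a b) {φ : ℝ → ℝ} (hφ : Continuous φ)
    (hs : HasCompactSupport φ) : IntegrableOn (fun x => φ x • f x) (Ioo a b) := by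
  obtain ⟨C, hC⟩ := hs.exists_bound_of_continuous hφ
  exact (integrable_L2 f).bdd_smul C hφ.aestronglyMeasurable (Filter.Eventually.of_forall hC)

lemma ae_zero_of_test (f : ℝ → ℂ) (hf : IntegrableOn f (Ioo a b))
    (h : ∀ φ : ℝ → ℝ, ContDiff ℝ ∞ φ → HasCompactSupport φ → tsupport φ ⊆ Ioo a b →
      ∫ x in Ioo a b, φ x • f x = 0) : f =ᵐ[volume.restrict (Ioo a b)] 0 := by
  have key := isOpen_Ioo.ae_eq_zero_of_integral_contDiff_smul_eq_zero (μ := volume)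
    hf.locallyIntegrableOn (fun φ h1 h2 h3 => by
      rw [← h φ h1 h2 h3, setIntegral_eq_integral_of_forall_compl_eq_zero]
      intro x hx
      rw [image_eq_zero_of_notMem_tsupport (fun hh => hx (h3 hh)), zero_smul])
  exact (ae_restrict_iff' measurableSet_Ioo).2 key

lemma IsWeakDeriv.unique {f g g' : L2 a b} (h : IsWeakDeriv f g) (h' : IsWeakDeriv f g') :
    g = g' := by
  apply Lp.ext
  have := ae_zero_of_test (a := a) (b := b) (fun x => g x - g' x)
    ((integrable_L2 g).sub (integrable_L2 g')) (fun φ h1 h2 h3 => by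
      simp only [smul_sub]
      rw [integral_sub (integrable_smul_L2 g h1.continuous h2)
        (integrable_smul_L2 g' h1.continuous h2), sub_eq_zero]
      exact neg_injective ((h φ h1 h2 h3).symm.trans (h' φ h1 h2 h3)))
  filter_upwards [this] with x hx
  exact sub_eq_zero.1 hx

lemma IsWeakDeriv.add {f f' g g' : L2 a b} (h : IsWeakDeriv f g) (h' : IsWeakDeriv f' g') :
    IsWeakDeriv (f + f') (g + g') := by
  intro φ h1 h2 h3
  have hd : Continuous (deriv φ) := h1.continuous_deriv (by simp)
  have e1 : ∫ x in Ioo a b, deriv φ x • (f + f' : L2 a b) x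
      = ∫ x in Ioo a b, (deriv φ x • f x + deriv φ x • f' x) := by
    refine integral_congr_ae ?_
    filter_upwards [Lp.coeFn_add f f'] with x hx
    rw [hx, Pi.add_apply, smul_add]
  have e2 : ∫ x in Ioo a b, φ x • (g + g' : L2 a b) x
      = ∫ x in Ioo a b, (φ x • g x + φ x • g' x) := by
    refine integral_congr_ae ?_
    filter_upwards [Lp.coeFn_add g g'] with x hx
    rw [hx, Pi.add_apply, smul_add]
  rw [e1, e2, integral_add (integrable_smul_L2 f hd h2.deriv) (integrable_smul_L2 f' hd h2.deriv),
    integral_add (integrable_smul_L2 g h1.continuous h2)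
      (integrable_smul_L2 g' h1.continuous h2), h φ h1 h2 h3, h' φ h1 h2 h3]
  ring

lemma IsWeakDeriv.smul {f g : L2 a b} (c : ℂ) (h : IsWeakDeriv f g) :
    IsWeakDeriv (c • f) (c • g) := by
  intro φ h1 h2 h3
  have e1 : ∫ x in Ioo a b, deriv φ x • (c • f : L2 a b) x
      = ∫ x in Ioo a b, c • (deriv φ x • f x) := by
    refine integral_congr_ae ?_
    filter_upwards [Lp.coeFn_smul c f] with x hx
    rw [hx, Pi.smul_apply, smul_comm]
  have e2 : ∫ x in Ioo a b, φ x • (c • g : L2 a b) x = ∫ x in Ioo a b, c • (φ x • g x) := by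
    refine integral_congr_ae ?_
    filter_upwards [Lp.coeFn_smul c g] with x hx
    rw [hx, Pi.smul_apply, smul_comm]
  rw [e1, e2, integral_smul, integral_smul, h φ h1 h2 h3, smul_neg]

lemma isWeakDeriv_zero : IsWeakDeriv (0 : L2 a b) 0 := by
  intro φ _ _ _
  have e (ψ : ℝ → ℝ) : ∫ x in Ioo a b, ψ x • (0 : L2 a b) x = 0 := by
    rw [← integral_zero ℝ ℂ (μ := volume.restrict (Ioo a b))]
    refine integral_congr_ae ?_
    filter_upwards [Lp.coeFn_zero ℂ 2 (volume.restrict (Ioo a b))] with x hx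
    rw [hx, Pi.zero_apply, smul_zero]
  rw [e, e, neg_zero]

lemma MemH1.isWeakDeriv {f : L2 a b} (h : MemH1 f) : IsWeakDeriv f (wderiv f) := by
  rw [wderiv, dif_pos h]
  exact h.choose_spec

lemma IsWeakDeriv.wderiv_eq {f g : L2 a b} (h : IsWeakDeriv f g) : wderiv f = g :=
  (MemH1.isWeakDeriv ⟨g, h⟩).unique h

lemma MemH1.zero : MemH1 (0 : L2 a b) := ⟨0, isWeakDeriv_zero⟩

lemma MemH1.add {f g : L2 a b} (hf : MemH1 f) (hg : MemH1 g) : MemH1 (f + g) :=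
  ⟨_, hf.isWeakDeriv.add hg.isWeakDeriv⟩

lemma MemH1.smul {f : L2 a b} (c : ℂ) (hf : MemH1 f) : MemH1 (c • f) :=
  ⟨_, hf.isWeakDeriv.smul c⟩

lemma wderiv_zero : wderiv (0 : L2 a b) = 0 := isWeakDeriv_zero.wderiv_eq

lemma wderiv_add {f g : L2 a b} (hf : MemH1 f) (hg : MemH1 g) :
    wderiv (f + g) = wderiv f + wderiv g :=
  (hf.isWeakDeriv.add hg.isWeakDeriv).wderiv_eq

lemma wderiv_smul {f : L2 a b} (c : ℂ) (hf : MemH1 f) : wderiv (c • f) = c • wderiv f :=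
  (hf.isWeakDeriv.smul c).wderiv_eq

lemma MemH2.zero : MemH2 (0 : L2 a b) := ⟨MemH1.zero, by rw [wderiv_zero]; exact MemH1.zero⟩

lemma MemH2.add {f g : L2 a b} (hf : MemH2 f) (hg : MemH2 g) : MemH2 (f + g) :=
  ⟨hf.1.add hg.1, by rw [wderiv_add hf.1 hg.1]; exact hf.2.add hg.2⟩

lemma MemH2.smul {f : L2 a b} (c : ℂ) (hf : MemH2 f) : MemH2 (c • f) :=
  ⟨hf.1.smul c, by rw [wderiv_smul c hf.1]; exact hf.2.smul c⟩

lemma HasValue.zero (c : ℝ) : HasValue (0 : L2 a b) c 0 :=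
  ⟨0, continuousOn_const, Lp.coeFn_zero _ _ _, rfl⟩

lemma HasValue.add {f g : L2 a b} {c : ℝ} {y z : ℂ} (hf : HasValue f c y) (hg : HasValue g c z) :
    HasValue (f + g) c (y + z) := by
  obtain ⟨F, h1, h2, rfl⟩ := hf
  obtain ⟨G, k1, k2, rfl⟩ := hg
  exact ⟨F + G, h1.add k1, (Lp.coeFn_add f g).trans (h2.add k2), rfl⟩

lemma HasValue.smul {f : L2 a b} {c : ℝ} {y : ℂ} (r : ℂ) (hf : HasValue f c y) :
    HasValue (r • f) c (r • y) := by
  obtain ⟨F, h1, h2, rfl⟩ := hf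
  exact ⟨r • F, h1.const_smul r, (Lp.coeFn_smul r f).trans (h2.const_smul r), rfl⟩

/-- The value of the continuous representative at a point of `[a,b]` is unique. -/
lemma HasValue.unique (hab : a < b) {f : L2 a b} {c : ℝ} (hc : c ∈ Icc a b) {y z : ℂ}
    (hf : HasValue f c y) (hg : HasValue f c z) : y = z := by
  obtain ⟨F, h1, h2, rfl⟩ := hf
  obtain ⟨G, k1, k2, rfl⟩ := hg
  have hFG : F =ᵐ[volume.restrict (Icc a b)] G := by
    rw [← restrict_Ioo_eq_restrict_Icc]
    exact h2.symm.trans k2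
  exact Measure.eqOn_Icc_of_ae_eq volume hab.ne hFG h1 k1 hc

/-- A function with vanishing weak derivative is almost everywhere constant. -/
lemma IsWeakDeriv.ae_const (hab : a < b) {f : L2 a b} (h : IsWeakDeriv f 0) :
    ∃ k : ℂ, f =ᵐ[volume.restrict (Ioo a b)] fun _ => k := by
  let B : ContDiffBump ((a + b) / 2) :=
    { rIn := (b - a) / 8, rOut := (b - a) / 4, rIn_pos := by linarith, rIn_lt_rOut := by linarith }
  let ψ : ℝ → ℝ := B.normed volume
  have ψ1 : ContDiff ℝ ∞ ψ := B.contDiff_normed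
  have ψ2 : HasCompactSupport ψ := B.hasCompactSupport_normed
  have ψ3 : tsupport ψ ⊆ Ioo a b := by
    rw [B.tsupport_normed_eq, Real.closedBall_eq_Icc]
    change Icc ((a + b) / 2 - (b - a) / 4) ((a + b) / 2 + (b - a) / 4) ⊆ _
    exact Icc_subset_Ioo (by linarith) (by linarith)
  have ψ4 : ∫ x, ψ x = 1 := B.integral_normed
  refine ⟨∫ x in Ioo a b, ψ x • f x, ?_⟩
  set k := ∫ x in Ioo a b, ψ x • f x with hk
  have key := ae_zero_of_test (a := a) (b := b) (fun x => f x - k)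
    ((integrable_L2 f).sub (integrableOn_const (by simp))) (fun φ h1 h2 h3 => by
    set m : ℝ := ∫ x, φ x with hm
    let θ : ℝ → ℝ := fun x => φ x - m * ψ x
    have θc : ContDiff ℝ ∞ θ := h1.sub (contDiff_const.mul ψ1)
    have θs : HasCompactSupport θ := h2.sub (ψ2.mul_left (f := fun _ => m))
    have θi : Integrable θ := θc.continuous.integrable_of_hasCompactSupport θs
    have θ0 : ∫ x, θ x = 0 := by
      change ∫ x, (φ x - m * ψ x) = 0
      rw [integral_sub (h1.continuous.integrable_of_hasCompactSupport h2)
        ((ψ1.continuous.integrable_of_hasCompactSupport ψ2).const_mul m), integral_const_mul, ψ4]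
      simp [hm]
    have θt : tsupport θ ⊆ Ioo a b := by
      refine (tsupport_sub φ (fun x => m * ψ x)).trans (union_subset h3 ?_)
      exact (tsupport_mul_subset_right (f := fun _ => m)).trans ψ3
    let Θ : ℝ → ℝ := fun x => ∫ t in a..x, θ t
    have Θd : ∀ x, HasDerivAt Θ (θ x) x := fun x =>
      intervalIntegral.integral_hasDerivAt_right (θc.continuous.intervalIntegrable _ _)
        (θc.continuous.stronglyMeasurableAtFilter _ _) θc.continuous.continuousAt
    have Θd' : deriv Θ = θ := funext fun x => (Θd x).deriv
    have Θ1 : ContDiff ℝ ∞ Θ := by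
      rw [contDiff_infty_iff_deriv]
      exact ⟨fun x => (Θd x).differentiableAt, by rw [Θd']; exact θc⟩
    have θz : ∀ x, x ∉ tsupport θ → θ x = 0 := fun x => image_eq_zero_of_notMem_tsupport
    -- the support of `Θ` lies in a compact subinterval
    obtain ⟨c, d, hac, hdb, hcd⟩ : ∃ c d, a < c ∧ d < b ∧ tsupport θ ⊆ Icc c d := by
      rcases (tsupport θ).eq_empty_or_nonempty with he | hne
      · exact ⟨b, a, hab, hab, by simp [he]⟩
      · have hcpt : IsCompact (tsupport θ) := θs
        exact ⟨sInf (tsupport θ), sSup (tsupport θ), (θt (hcpt.sInf_mem hne)).1,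
          (θt (hcpt.sSup_mem hne)).2, fun x hx =>
            ⟨csInf_le hcpt.bddBelow hx, le_csSup hcpt.bddAbove hx⟩⟩
    have Θ2 : Function.support Θ ⊆ Icc c d := by
      intro x hx
      by_contra hxn
      apply hx
      rw [mem_Icc, not_and_or, not_le, not_le] at hxn
      rcases hxn with hxc | hxd
      · change ∫ t in a..x, θ t = 0
        rw [intervalIntegral.integral_congr (g := fun _ => (0 : ℝ)), intervalIntegral.integral_zero]
        intro t ht
        refine θz t fun hh => ?_
        have := (hcd hh).1
        have := ht.2
        have : a ⊔ x < c := max_lt hac hxc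
        linarith
      · change ∫ t in a..x, θ t = 0
        have hfull : ∫ t in a..x, θ t = ∫ t, θ t := by
          rcases le_or_gt a x with hax | hax
          · rw [intervalIntegral.integral_of_le hax]
            refine setIntegral_eq_integral_of_forall_compl_eq_zero fun t ht => θz t fun hh => ht ?_
            exact ⟨(θt hh).1, ((hcd hh).2.trans_lt hxd).le⟩
          · have hz : ∀ t, θ t = 0 := fun t => θz t fun hh => by
              have := (hcd hh).2
              have := (θt hh).1
              linarith
            simp [hz]
        rw [hfull, θ0]
    have Θ3 : HasCompactSupport Θ := isCompact_Icc.of_isClosed_subset (isClosed_tsupport _)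
      (closure_minimal Θ2 isClosed_Icc)
    have Θ4 : tsupport Θ ⊆ Ioo a b :=
      (closure_minimal Θ2 isClosed_Icc).trans fun x hx => ⟨hac.trans_le hx.1, hx.2.trans_lt hdb⟩
    have hw := h Θ Θ1 Θ3 Θ4
    have hz : ∫ x in Ioo a b, Θ x • (0 : L2 a b) x = 0 := by
      rw [← integral_zero ℝ ℂ (μ := volume.restrict (Ioo a b))]
      refine integral_congr_ae ?_
      filter_upwards [Lp.coeFn_zero ℂ 2 (volume.restrict (Ioo a b))] with x hx
      rw [hx, Pi.zero_apply, smul_zero]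
    rw [hz, neg_zero, Θd'] at hw
    have hsplit : ∫ x in Ioo a b, θ x • f x = (∫ x in Ioo a b, φ x • f x) - m • k := by
      have hi : IntegrableOn (fun x => m • ψ x • f x) (Ioo a b) :=
        (integrable_smul_L2 f ψ1.continuous ψ2).smul m
      rw [hk, ← integral_smul, ← integral_sub (integrable_smul_L2 f h1.continuous h2) hi]
      refine integral_congr_ae (Filter.Eventually.of_forall fun x => ?_)
      simp only [θ, sub_smul, mul_smul]
    rw [hsplit, sub_eq_zero] at hw
    simp only [smul_sub]
    have hconst : ∫ x in Ioo a b, φ x • k = m • k := by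
      rw [integral_smul_const, setIntegral_eq_integral_of_forall_compl_eq_zero]
      exact fun x hx => image_eq_zero_of_notMem_tsupport fun hh => hx (h3 hh)
    rw [integral_sub (integrable_smul_L2 f h1.continuous h2)
      ((h1.continuous.integrable_of_hasCompactSupport h2).integrableOn.smul_const k), hw, hconst,
      sub_self])
  filter_upwards [key] with x hx
  exact sub_eq_zero.1 hx

/-- An `H¹` function with zero derivative and zero value at one point of `[a,b]` vanishes. -/
lemma eq_zero_of_wderiv (hab : a < b) {f : L2 a b} (hf : MemH1 f) (hd : wderiv f = 0) {c : ℝ}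
    (hc : c ∈ Icc a b) (hv : HasValue f c 0) : f = 0 := by
  obtain ⟨k, hk⟩ := IsWeakDeriv.ae_const hab (hd ▸ hf.isWeakDeriv)
  have hk0 : k = 0 :=
    HasValue.unique hab hc ⟨fun _ => k, continuousOn_const, hk, rfl⟩ hv
  apply Lp.ext
  filter_upwards [hk, Lp.coeFn_zero ℂ 2 (volume.restrict (Ioo a b))] with x hx h0
  rw [hx, h0, hk0, Pi.zero_apply]

end basic

/-! ## The energy space -/

/-- The energy space `X`: all `(u, v, w, ũ, ṽ)` with `u ∈ H¹(0,1)`, `v ∈ L²(0,1)`, `w ∈ L²(1,2)`,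
`ũ ∈ H¹(2,3)`, `ṽ ∈ L²(2,3)` and `u(0) = ũ(3) = 0`. -/
structure State where
  /-- Displacement of the left wave. -/
  u : L2 0 1
  /-- Velocity of the left wave. -/
  v : L2 0 1
  /-- Temperature. -/
  w : L2 1 2
  /-- Displacement of the right wave. -/
  ut : L2 2 3
  /-- Velocity of the right wave. -/
  vt : L2 2 3
  memH1_u : MemH1 u
  memH1_ut : MemH1 ut
  value_u : HasValue u 0 0
  value_ut : HasValue ut 3 0

namespace State

lemma ext {x y : State} (h1 : x.u = y.u) (h2 : x.v = y.v) (h3 : x.w = y.w) (h4 : x.ut = y.ut)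
    (h5 : x.vt = y.vt) : x = y := by
  cases x; cases y; simp_all

instance : Zero State :=
  ⟨⟨0, 0, 0, 0, 0, MemH1.zero, MemH1.zero, HasValue.zero 0, HasValue.zero 3⟩⟩

instance : Add State :=
  ⟨fun x y => ⟨x.u + y.u, x.v + y.v, x.w + y.w, x.ut + y.ut, x.vt + y.vt,
    x.memH1_u.add y.memH1_u, x.memH1_ut.add y.memH1_ut,
    by simpa using x.value_u.add y.value_u, by simpa using x.value_ut.add y.value_ut⟩⟩

instance : SMul ℂ State :=
  ⟨fun c x => ⟨c • x.u, c • x.v, c • x.w, c • x.ut, c • x.vt,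
    x.memH1_u.smul c, x.memH1_ut.smul c,
    by simpa using x.value_u.smul c, by simpa using x.value_ut.smul c⟩⟩

instance : Neg State := ⟨fun x => (-1 : ℂ) • x⟩

@[simp] lemma add_u (x y : State) : (x + y).u = x.u + y.u := rfl
@[simp] lemma add_v (x y : State) : (x + y).v = x.v + y.v := rfl
@[simp] lemma add_w (x y : State) : (x + y).w = x.w + y.w := rfl
@[simp] lemma add_ut (x y : State) : (x + y).ut = x.ut + y.ut := rfl
@[simp] lemma add_vt (x y : State) : (x + y).vt = x.vt + y.vt := rfl
@[simp] lemma smul_u (c : ℂ) (x : State) : (c • x).u = c • x.u := rfl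
@[simp] lemma smul_v (c : ℂ) (x : State) : (c • x).v = c • x.v := rfl
@[simp] lemma smul_w (c : ℂ) (x : State) : (c • x).w = c • x.w := rfl
@[simp] lemma smul_ut (c : ℂ) (x : State) : (c • x).ut = c • x.ut := rfl
@[simp] lemma smul_vt (c : ℂ) (x : State) : (c • x).vt = c • x.vt := rfl
@[simp] lemma zero_u : (0 : State).u = 0 := rfl
@[simp] lemma zero_v : (0 : State).v = 0 := rfl
@[simp] lemma zero_w : (0 : State).w = 0 := rfl
@[simp] lemma zero_ut : (0 : State).ut = 0 := rfl
@[simp] lemma zero_vt : (0 : State).vt = 0 := rfl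

instance : AddCommGroup State where
  add_assoc x y z := by apply State.ext <;> simp [add_assoc]
  zero_add x := by apply State.ext <;> simp
  add_zero x := by apply State.ext <;> simp
  add_comm x y := by apply State.ext <;> simp [add_comm]
  nsmul := nsmulRec
  zsmul := zsmulRec
  neg_add_cancel x := by
    change (-1 : ℂ) • x + x = 0
    apply State.ext <;> simp

instance : Module ℂ State where
  one_smul x := by apply State.ext <;> simp
  mul_smul c d x := by apply State.ext <;> simp [mul_smul]
  smul_zero c := by apply State.ext <;> simp
  smul_add c x y := by apply State.ext <;> simp
  add_smul c d x := by apply State.ext <;> simp [add_smul]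
  zero_smul x := by apply State.ext <;> simp

/-- The energy inner product
`⟨x, y⟩ = ⟨u', u'⟩ + ⟨v, v⟩ + ⟨w, w⟩ + ⟨ũ', ũ'⟩ + ⟨ṽ, ṽ⟩` (sums of `L²` inner products of the
corresponding components of `x` and `y`). -/
@[reducible]
def innerCore : InnerProductSpace.Core ℂ State where
  inner x y := ⟪wderiv x.u, wderiv y.u⟫_ℂ + ⟪x.v, y.v⟫_ℂ + ⟪x.w, y.w⟫_ℂ
    + ⟪wderiv x.ut, wderiv y.ut⟫_ℂ + ⟪x.vt, y.vt⟫_ℂ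
  conj_inner_symm x y := by simp only [map_add, inner_conj_symm]
  re_inner_nonneg x := by
    simp only [map_add]
    exact add_nonneg (add_nonneg (add_nonneg (add_nonneg inner_self_nonneg inner_self_nonneg)
      inner_self_nonneg) inner_self_nonneg) inner_self_nonneg
  add_left x y z := by
    simp only [add_u, add_v, add_w, add_ut, add_vt, wderiv_add x.memH1_u y.memH1_u,
      wderiv_add x.memH1_ut y.memH1_ut, inner_add_left]
    ring
  smul_left x y c := by
    simp only [smul_u, smul_v, smul_w, smul_ut, smul_vt, wderiv_smul c x.memH1_u,
      wderiv_smul c x.memH1_ut, inner_smul_left]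
    ring
  definite x h := by
    have h' := congrArg Complex.re h
    simp only [Complex.add_re, Complex.zero_re] at h'
    have hn : ∀ {a b : ℝ} (f : L2 a b), (⟪f, f⟫_ℂ).re = ‖f‖ ^ 2 := fun f =>
      (norm_sq_eq_re_inner (𝕜 := ℂ) f).symm
    simp only [hn] at h'
    have hz : ∀ {r : ℝ}, r ^ 2 ≤ 0 → r = 0 := fun {r} hr =>
      pow_eq_zero_iff (two_ne_zero) |>.1 (le_antisymm hr (sq_nonneg r))
    have s1 := sq_nonneg ‖wderiv x.u‖
    have s2 := sq_nonneg ‖x.v‖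
    have s3 := sq_nonneg ‖x.w‖
    have s4 := sq_nonneg ‖wderiv x.ut‖
    have s5 := sq_nonneg ‖x.vt‖
    refine State.ext ?_ ?_ ?_ ?_ ?_
    · exact eq_zero_of_wderiv (by norm_num) x.memH1_u (norm_eq_zero.1 (hz (by linarith)))
        (by norm_num) x.value_u
    · exact norm_eq_zero.1 (hz (by linarith))
    · exact norm_eq_zero.1 (hz (by linarith))
    · exact eq_zero_of_wderiv (by norm_num) x.memH1_ut (norm_eq_zero.1 (hz (by linarith)))
        (by norm_num) x.value_ut
    · exact norm_eq_zero.1 (hz (by linarith))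

instance : NormedAddCommGroup State := innerCore.toNormedAddCommGroup

instance : InnerProductSpace ℂ State := InnerProductSpace.ofCore innerCore.toCore

/-- The norm of the energy space is the energy norm. -/
lemma norm_sq_eq (x : State) :
    ‖x‖ ^ 2 = ‖wderiv x.u‖ ^ 2 + ‖x.v‖ ^ 2 + ‖x.w‖ ^ 2 + ‖wderiv x.ut‖ ^ 2 + ‖x.vt‖ ^ 2 := by
  rw [@norm_sq_eq_re_inner ℂ]
  change RCLike.re (⟪wderiv x.u, wderiv x.u⟫_ℂ + ⟪x.v, x.v⟫_ℂ + ⟪x.w, x.w⟫_ℂ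
    + ⟪wderiv x.ut, wderiv x.ut⟫_ℂ + ⟪x.vt, x.vt⟫_ℂ) = _
  simp only [map_add, ← norm_sq_eq_re_inner]

end State

/-! ## The operator -/

/-- The domain of the wave–heat–wave operator: `u ∈ H²(0,1)`, `v ∈ H¹(0,1)`, `w ∈ H²(1,2)`,
`ũ ∈ H²(2,3)`, `ṽ ∈ H¹(2,3)`, `v(0) = ṽ(3) = 0`, `u'(1) = w'(1)`, `v(1) = w(1)`,
`ũ'(2) = w'(2)`, `ṽ(2) = w(2)`. -/
def genDomain : Submodule ℂ State where
  carrier := {x | MemH2 x.u ∧ MemH1 x.v ∧ MemH2 x.w ∧ MemH2 x.ut ∧ MemH1 x.vt ∧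
    HasValue x.v 0 0 ∧ HasValue x.vt 3 0 ∧
    (∃ y, HasValue (wderiv x.u) 1 y ∧ HasValue (wderiv x.w) 1 y) ∧
    (∃ y, HasValue x.v 1 y ∧ HasValue x.w 1 y) ∧
    (∃ y, HasValue (wderiv x.ut) 2 y ∧ HasValue (wderiv x.w) 2 y) ∧
    (∃ y, HasValue x.vt 2 y ∧ HasValue x.w 2 y)}
  zero_mem' := by
    simp only [mem_ofPred_eq, State.zero_u, State.zero_v, State.zero_w, State.zero_ut,
      State.zero_vt, wderiv_zero]
    exact ⟨MemH2.zero, MemH1.zero, MemH2.zero, MemH2.zero, MemH1.zero, HasValue.zero 0,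
      HasValue.zero 3, ⟨0, HasValue.zero 1, HasValue.zero 1⟩, ⟨0, HasValue.zero 1, HasValue.zero 1⟩,
      ⟨0, HasValue.zero 2, HasValue.zero 2⟩, ⟨0, HasValue.zero 2, HasValue.zero 2⟩⟩
  add_mem' := by
    rintro x y ⟨h1, h2, h3, h4, h5, h6, h7, ⟨p, p1, p2⟩, ⟨q, q1, q2⟩, ⟨r, r1, r2⟩, ⟨s, s1, s2⟩⟩
      ⟨k1, k2, k3, k4, k5, k6, k7, ⟨p', p1', p2'⟩, ⟨q', q1', q2'⟩, ⟨r', r1', r2'⟩, ⟨s', s1', s2'⟩⟩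
    simp only [mem_ofPred_eq, State.add_u, State.add_v, State.add_w, State.add_ut, State.add_vt,
      wderiv_add h1.1 k1.1, wderiv_add h3.1 k3.1, wderiv_add h4.1 k4.1]
    exact ⟨h1.add k1, h2.add k2, h3.add k3, h4.add k4, h5.add k5, by simpa using h6.add k6,
      by simpa using h7.add k7, ⟨_, p1.add p1', p2.add p2'⟩, ⟨_, q1.add q1', q2.add q2'⟩,
      ⟨_, r1.add r1', r2.add r2'⟩, ⟨_, s1.add s1', s2.add s2'⟩⟩
  smul_mem' := by
    rintro c x ⟨h1, h2, h3, h4, h5, h6, h7, ⟨p, p1, p2⟩, ⟨q, q1, q2⟩, ⟨r, r1, r2⟩, ⟨s, s1, s2⟩⟩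
    simp only [mem_ofPred_eq, State.smul_u, State.smul_v, State.smul_w, State.smul_ut,
      State.smul_vt, wderiv_smul c h1.1, wderiv_smul c h3.1, wderiv_smul c h4.1]
    exact ⟨h1.smul c, h2.smul c, h3.smul c, h4.smul c, h5.smul c, by simpa using h6.smul c,
      by simpa using h7.smul c, ⟨_, p1.smul c, p2.smul c⟩, ⟨_, q1.smul c, q2.smul c⟩,
      ⟨_, r1.smul c, r2.smul c⟩, ⟨_, s1.smul c, s2.smul c⟩⟩

/-- The value `A (u, v, w, ũ, ṽ) = (v, u'', w'', ṽ, ũ'')` for `(u, v, w, ũ, ṽ) ∈ D(A)`. -/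
def genFun (x : genDomain) : State :=
  State.mk x.1.v (wderiv (wderiv x.1.u)) (wderiv (wderiv x.1.w)) x.1.vt (wderiv (wderiv x.1.ut))
    x.2.2.1 x.2.2.2.2.2.1 x.2.2.2.2.2.2.1 x.2.2.2.2.2.2.2.1

@[simp] lemma genFun_u (x : genDomain) : (genFun x).u = x.1.v := rfl
@[simp] lemma genFun_v (x : genDomain) : (genFun x).v = wderiv (wderiv x.1.u) := rfl
@[simp] lemma genFun_w (x : genDomain) : (genFun x).w = wderiv (wderiv x.1.w) := rfl
@[simp] lemma genFun_ut (x : genDomain) : (genFun x).ut = x.1.vt := rfl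
@[simp] lemma genFun_vt (x : genDomain) : (genFun x).vt = wderiv (wderiv x.1.ut) := rfl

lemma genFun_add (x y : genDomain) : genFun (x + y) = genFun x + genFun y := by
  obtain ⟨x, hx⟩ := x
  obtain ⟨y, hy⟩ := y
  apply State.ext
  · simp only [genFun_u, State.add_u, Submodule.coe_add, State.add_v]
  · simp only [genFun_v, State.add_u, Submodule.coe_add, State.add_v]
    rw [wderiv_add hx.1.1 hy.1.1, wderiv_add hx.1.2 hy.1.2]
  · simp only [genFun_w, Submodule.coe_add, State.add_w]
    rw [wderiv_add hx.2.2.1.1 hy.2.2.1.1, wderiv_add hx.2.2.1.2 hy.2.2.1.2]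
  · simp only [genFun_ut, State.add_ut, Submodule.coe_add, State.add_vt]
  · simp only [genFun_vt, State.add_ut, Submodule.coe_add, State.add_vt]
    rw [wderiv_add hx.2.2.2.1.1 hy.2.2.2.1.1, wderiv_add hx.2.2.2.1.2 hy.2.2.2.1.2]

lemma genFun_smul (c : ℂ) (x : genDomain) : genFun (c • x) = c • genFun x := by
  obtain ⟨x, hx⟩ := x
  apply State.ext
  · simp only [genFun_u, State.smul_u, Submodule.coe_smul, State.smul_v]
  · simp only [genFun_v, State.smul_u, Submodule.coe_smul, State.smul_v]
    rw [wderiv_smul c hx.1.1, wderiv_smul c hx.1.2]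
  · simp only [genFun_w, Submodule.coe_smul, State.smul_w]
    rw [wderiv_smul c hx.2.2.1.1, wderiv_smul c hx.2.2.1.2]
  · simp only [genFun_ut, State.smul_ut, Submodule.coe_smul, State.smul_vt]
  · simp only [genFun_vt, State.smul_ut, Submodule.coe_smul, State.smul_vt]
    rw [wderiv_smul c hx.2.2.2.1.1, wderiv_smul c hx.2.2.2.1.2]

/-- The wave–heat–wave operator `A` with domain `D(A)`. -/
def generator : State →ₗ.[ℂ] State where
  domain := genDomain
  toFun := { toFun := genFun, map_add' := genFun_add, map_smul' := genFun_smul }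

/-! ## Resolvents of unbounded operators -/

section resolvent

variable {E : Type*} [NormedAddCommGroup E] [NormedSpace ℂ E]

/-- The bounded operator `R` is a two-sided inverse of `z - A : D(A) → E`. -/
def IsResolvent (A : E →ₗ.[ℂ] E) (z : ℂ) (R : E →L[ℂ] E) : Prop :=
  (∀ y : E, ∃ h : R y ∈ A.domain, z • R y - A ⟨R y, h⟩ = y) ∧
    ∀ x : A.domain, R (z • (x : E) - A x) = x

/-- The resolvent set `ρ(A)` of an unbounded operator. -/
def resolventSet (A : E →ₗ.[ℂ] E) : Set ℂ := {z | ∃ R : E →L[ℂ] E, IsResolvent A z R}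

open Classical in
/-- The resolvent operator `R(z, A) = (z - A)⁻¹` for `z ∈ ρ(A)` (and `0` for `z ∉ ρ(A)`). -/
def resolventOp (A : E →ₗ.[ℂ] E) (z : ℂ) : E →L[ℂ] E :=
  if h : z ∈ resolventSet A then h.choose else 0

lemma IsResolvent.unique {A : E →ₗ.[ℂ] E} {z : ℂ} {R S : E →L[ℂ] E} (hR : IsResolvent A z R)
    (hS : IsResolvent A z S) : R = S := by
  ext y
  obtain ⟨h, hy⟩ := hS.1 y
  have := hR.2 ⟨S y, h⟩
  rw [hy] at this
  exact this

lemma IsResolvent.resolventOp_eq {A : E →ₗ.[ℂ] E} {z : ℂ} {R : E →L[ℂ] E}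
    (hR : IsResolvent A z R) : resolventOp A z = R := by
  have h : z ∈ resolventSet A := ⟨R, hR⟩
  rw [resolventOp, dif_pos h]
  exact h.choose_spec.unique hR

end resolvent

end

end WHW

namespace WHW

noncomputable section

open MeasureTheory Set
open scoped ContDiff InnerProductSpace

/-! ## Integration by parts for primitives of integrable functions -/

section primitive

variable {a b : ℝ}

/-! Only the heat part dissipates: for `F = (is - A) x` the real part of `⟪x, F⟫` is `‖w'‖²`,
because all coupling terms cancel at 1 and 2 (`re_inner_resolventEquation`). Hence `‖w'‖² ≤ ‖F‖
‖x‖`. Multiplying the wave equations by `x - c`, with `c` the outer end of the wave interval, bounds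
the energy of each wave, uniformly in `s`, by its data at the interface (`wave_estimate_right`,
`wave_estimate_left`). By the coupling these data are the traces of `w` and `w'`, which are
controlled by `‖w‖`, `‖w'‖` and `‖w''‖`, where `w'' = is w - F.w`.

It remains to bound `‖w‖`. Testing the heat equation with `w` and taking imaginary parts gives `|s|
‖w‖² ≤ 2Bb + ‖F‖ ‖x‖`, where `B` and `b` bound the traces of `w'` and `w`. Put `e² = ‖F‖ ‖x‖`. Away
from `s = 0` the inequalities close up to `|s|^(1/2) ‖w‖ ≲ e`, then `B² ≲ |s|^(1/2) e²`, and finally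
`‖x‖² ≲ |s|^(1/2) ‖F‖ ‖x‖` (`resolvent_bound_of_pos`). The trace of `w'` is the source of the power
1/2.

These are a priori bounds; existence comes from continuity in `s`. At `s = 0` the equation is solved
by repeated integration (`generator_surjective`), and `R = -A⁻¹` is bounded. The factorization `(is
- A) R = 1 + is R` reduces invertibility of `is - A` to that of `1 + is R`. The set of real `s` for
which the latter is invertible is open, and closed by the a priori bounds, so it is all of `ℝ`
(`isUnit_one_add_smul`). This uses completeness of the energy space. -/

lemma intervalIntegral_eq_integral_ite {f : ℝ → ℂ} {x : ℝ} (hx : x ∈ Ioo a b) :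
    ∫ t in a..x, f t = ∫ t in Ioo a b, if t ≤ x then f t else 0 := by
  rw [intervalIntegral.integral_of_le hx.1.le]
  have : (fun t => if t ≤ x then f t else 0) = (Iic x).indicator f := by
    ext t
    simp [indicator_apply]
  rw [this, setIntegral_indicator measurableSet_Iic]
  congr 2
  ext t
  simp only [mem_Ioc, mem_inter_iff, mem_Ioo, mem_Iic]
  exact ⟨fun h => ⟨⟨h.1, h.2.trans_lt hx.2⟩, h.2⟩, fun h => ⟨h.1.1, h.2⟩⟩

lemma integrable_prod_ite {μ : Measure ℝ} [SFinite μ] {f g : ℝ → ℂ} (hf : Integrable f μ)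
    (hg : Integrable g μ) :
    Integrable (fun p : ℝ × ℝ => if p.2 ≤ p.1 then g p.1 * f p.2 else 0) (μ.prod μ) := by
  have : (fun p : ℝ × ℝ => if p.2 ≤ p.1 then g p.1 * f p.2 else 0)
      = {p : ℝ × ℝ | p.2 ≤ p.1}.indicator (fun p => g p.1 * f p.2) := by
    ext p
    simp [indicator_apply]
  rw [this]
  exact (hg.mul_prod hf).indicator (measurableSet_le measurable_snd measurable_fst)

/-- Fubini: the two terms are the integrals of `g x * f t` over the two triangles into which the
diagonal cuts the square. Only integrability is required, so no derivative of a primitive is ever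
taken. -/
lemma integral_primitive_mul_add (hab : a ≤ b) {f g : ℝ → ℂ} (hf : IntegrableOn f (Ioo a b))
    (hg : IntegrableOn g (Ioo a b)) :
    (∫ x in Ioo a b, g x * ∫ t in a..x, f t) + (∫ x in Ioo a b, f x * ∫ t in a..x, g t)
      = (∫ t in a..b, f t) * ∫ t in a..b, g t := by
  set μ := volume.restrict (Ioo a b) with hμ
  have e (f g : ℝ → ℂ) : ∫ x in Ioo a b, g x * ∫ t in a..x, f t
      = ∫ x, ∫ t, (if t ≤ x then g x * f t else 0) ∂μ ∂μ := by
    refine setIntegral_congr_fun measurableSet_Ioo fun x hx => ?_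
    rw [intervalIntegral_eq_integral_ite hx, ← integral_const_mul]
    simp only [mul_ite, mul_zero, hμ]
  have i1 := integrable_prod_ite hf hg
  have i2 := (integrable_prod_ite hg hf).swap
  have swap := integral_integral_swap (f := fun x t => if t ≤ x then f x * g t else 0)
    (integrable_prod_ite hg hf)
  rw [e f g, e g f, swap]
  have key : ∀ᵐ x ∂μ, (∫ t, (if t ≤ x then g x * f t else 0) ∂μ)
      + (∫ t, (if x ≤ t then f t * g x else 0) ∂μ) = g x * ∫ t, f t ∂μ := by
    filter_upwards [i1.prod_right_ae, i2.prod_right_ae] with x h1 h2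
    rw [← integral_const_mul]
    refine (integral_add h1 h2).symm.trans (integral_congr_ae ?_)
    -- The two triangles overlap only on the diagonal, which is null in each fibre.
    have hne : ∀ᵐ t ∂μ, t ≠ x := by
      refine ae_restrict_of_ae ?_
      simp [ae_iff]
    filter_upwards [hne] with t ht
    rcases lt_or_gt_of_ne ht with h | h
    · simp [h.le, h.not_ge]
    · simp [h.le, h.not_ge, mul_comm]
  refine (integral_add i1.integral_prod_left i2.integral_prod_left).symm.trans
    ((integral_congr_ae key).trans ?_)
  rw [integral_mul_const, intervalIntegral.integral_of_le hab,
    intervalIntegral.integral_of_le hab, integral_Ioc_eq_integral_Ioo,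
    integral_Ioc_eq_integral_Ioo, mul_comm]

lemma continuousOn_primitive_Icc (hab : a ≤ b) {f : ℝ → ℂ} (hf : IntegrableOn f (Ioo a b)) :
    ContinuousOn (fun x => ∫ t in a..x, f t) (Icc a b) := by
  have := intervalIntegral.continuousOn_primitive_interval
    (by rw [uIcc_of_le hab]; exact (integrableOn_Icc_iff_integrableOn_Ioo).2 hf :
      IntegrableOn f (uIcc a b) volume)
  rwa [uIcc_of_le hab] at this

lemma integrableOn_mul_primitive (hab : a ≤ b) {f g : ℝ → ℂ} (hf : IntegrableOn f (Ioo a b))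
    (hg : IntegrableOn g (Ioo a b)) :
    IntegrableOn (fun x => g x * ∫ t in a..x, f t) (Ioo a b) := by
  have h := (integrableOn_Icc_iff_integrableOn_Ioo).2 hg |>.mul_continuousOn
    (continuousOn_primitive_Icc hab hf) isCompact_Icc
  exact h.mono_set Ioo_subset_Icc_self

/-- Integration by parts for two primitives of integrable functions. -/
lemma integral_const_add_primitive (hab : a ≤ b) {f g : ℝ → ℂ} (hf : IntegrableOn f (Ioo a b))
    (hg : IntegrableOn g (Ioo a b)) (k l : ℂ) :
    (∫ x in Ioo a b, g x * (k + ∫ t in a..x, f t)) + (∫ x in Ioo a b, f x * (l + ∫ t in a..x, g t))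
      = (k + ∫ t in a..b, f t) * (l + ∫ t in a..b, g t) - k * l := by
  simp only [mul_add]
  rw [integral_add (hg.mul_const k) (integrableOn_mul_primitive hab hf hg),
    integral_add (hf.mul_const l) (integrableOn_mul_primitive hab hg hf),
    integral_mul_const, integral_mul_const]
  have := integral_primitive_mul_add hab hf hg
  rw [intervalIntegral.integral_of_le hab, intervalIntegral.integral_of_le hab,
    integral_Ioc_eq_integral_Ioo, integral_Ioc_eq_integral_Ioo] at *
  linear_combination this

end primitive

/-! ## `H¹` functions as primitives -/

section sobolev

variable {a b : ℝ}

lemma memLp_of_continuousOn_Icc {F : ℝ → ℂ} (hF : ContinuousOn F (Icc a b)) :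
    MemLp F 2 (volume.restrict (Ioo a b)) := by
  have : IsFiniteMeasure (volume.restrict (Ioo a b)) := ⟨by simp⟩
  obtain ⟨C, hC⟩ := isCompact_Icc.exists_bound_of_continuousOn hF
  refine MemLp.of_bound ((hF.mono Ioo_subset_Icc_self).aestronglyMeasurable measurableSet_Ioo) C ?_
  filter_upwards [ae_restrict_mem measurableSet_Ioo] with x hx
  exact hC x (Ioo_subset_Icc_self hx)

/-- A test function is the primitive of its derivative and vanishes at both ends, so integration by
parts leaves no boundary term, whatever `k` is. -/
lemma isWeakDeriv_of_ae_eq_primitive (hab : a ≤ b) {f g : L2 a b} {k : ℂ}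
    (h : f =ᵐ[volume.restrict (Ioo a b)] fun x => k + ∫ t in a..x, g t) : IsWeakDeriv f g := by
  intro φ h1 h2 h3
  have hd : Continuous (deriv φ) := h1.continuous_deriv (by simp)
  have hφ (x : ℝ) : ∫ t in a..x, ((deriv φ t : ℝ) : ℂ) = φ x := by
    rw [intervalIntegral.integral_ofReal, intervalIntegral.integral_deriv_eq_sub
      (fun t _ => (h1.differentiable (by simp)).differentiableAt) (hd.intervalIntegrable _ _),
      image_eq_zero_of_notMem_tsupport (fun hh => (h3 hh).1.false), sub_zero]
  have hb : φ b = 0 := image_eq_zero_of_notMem_tsupport (fun hh => (h3 hh).2.false)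
  have hdi : IntegrableOn (fun x => ((deriv φ x : ℝ) : ℂ)) (Ioo a b) :=
    ((Complex.continuous_ofReal.comp hd).integrableOn_Icc (a := a) (b := b)).mono_set
      Ioo_subset_Icc_self
  have key := integral_const_add_primitive hab (integrable_L2 g) hdi k 0
  simp only [hφ, hb, Complex.ofReal_zero, mul_zero, sub_zero, zero_add] at key
  have e1 : ∫ x in Ioo a b, deriv φ x • f x
      = ∫ x in Ioo a b, ((deriv φ x : ℝ) : ℂ) * (k + ∫ t in a..x, g t) := by
    refine integral_congr_ae ?_
    filter_upwards [h] with x hx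
    rw [hx, Complex.real_smul]
  have e2 : ∫ x in Ioo a b, φ x • g x = ∫ x in Ioo a b, g x * (φ x : ℂ) := by
    simp only [Complex.real_smul, mul_comm]
  rw [e1, e2]
  exact eq_neg_of_add_eq_zero_left key

lemma continuousOn_const_add_primitive (hab : a ≤ b) (g : L2 a b) (k : ℂ) :
    ContinuousOn (fun x => k + ∫ t in a..x, g t) (Icc a b) :=
  continuousOn_const.add (continuousOn_primitive_Icc hab (integrable_L2 g))

lemma exists_isWeakDeriv (hab : a ≤ b) (g : L2 a b) (c : ℝ) (y : ℂ) :
    ∃ f : L2 a b, IsWeakDeriv f g ∧ HasValue f c y := by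
  have hF := continuousOn_const_add_primitive hab g (y - ∫ t in a..c, g t)
  have hL := memLp_of_continuousOn_Icc hF
  exact ⟨hL.toLp _, isWeakDeriv_of_ae_eq_primitive hab hL.coeFn_toLp, _, hF, hL.coeFn_toLp,
    by simp⟩

lemma IsWeakDeriv.sub {f f' g g' : L2 a b} (h : IsWeakDeriv f g) (h' : IsWeakDeriv f' g') :
    IsWeakDeriv (f - f') (g - g') := by
  simpa [sub_eq_add_neg] using h.add (h'.smul (-1))

/-- The primitive of `g` also has weak derivative `g`, so its difference from `f` has weak
derivative zero and is constant. -/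
lemma IsWeakDeriv.exists_ae_eq (hab : a < b) {f g : L2 a b} (h : IsWeakDeriv f g) :
    ∃ k : ℂ, f =ᵐ[volume.restrict (Ioo a b)] fun x => k + ∫ t in a..x, g t := by
  have hL := memLp_of_continuousOn_Icc (continuousOn_const_add_primitive hab.le g 0)
  have h0 : IsWeakDeriv (hL.toLp _) g := isWeakDeriv_of_ae_eq_primitive hab.le hL.coeFn_toLp
  have h1 := h.sub h0
  rw [sub_self] at h1
  obtain ⟨k, hk⟩ := h1.ae_const hab
  refine ⟨k, ?_⟩
  filter_upwards [hk, hL.coeFn_toLp, Lp.coeFn_sub f (hL.toLp _)] with x e1 e2 e3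
  rw [e1, Pi.sub_apply, e2] at e3
  rw [e3]
  ring

lemma IsWeakDeriv.exists_hasValue (hab : a < b) {f g : L2 a b} (h : IsWeakDeriv f g) (c : ℝ) :
    ∃ y, HasValue f c y := by
  obtain ⟨k, hk⟩ := h.exists_ae_eq hab
  exact ⟨_, _, continuousOn_const_add_primitive hab.le g k, hk, rfl⟩

lemma IsWeakDeriv.ae_eq_of_hasValue (hab : a < b) {f g : L2 a b} (h : IsWeakDeriv f g) {y : ℂ}
    (hy : HasValue f a y) :
    f =ᵐ[volume.restrict (Ioo a b)] fun x => y + ∫ t in a..x, g t := by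
  obtain ⟨k, hk⟩ := h.exists_ae_eq hab
  have := HasValue.unique hab (left_mem_Icc.2 hab.le) hy
    ⟨_, continuousOn_const_add_primitive hab.le g k, hk, rfl⟩
  rw [intervalIntegral.integral_same, add_zero] at this
  rwa [this]

lemma IsWeakDeriv.value_eq (hab : a < b) {f g : L2 a b} (h : IsWeakDeriv f g) {y z : ℂ}
    (hy : HasValue f a y) {c : ℝ} (hc : c ∈ Icc a b) (hz : HasValue f c z) :
    z = y + ∫ t in a..c, g t :=
  hz.unique hab hc
    ⟨_, continuousOn_const_add_primitive hab.le g y, h.ae_eq_of_hasValue hab hy, rfl⟩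

/-- Integration by parts in `H¹(a,b)`. -/
lemma IsWeakDeriv.inner_add_inner (hab : a < b) {f f' g g' : L2 a b} (hf : IsWeakDeriv f f')
    (hg : IsWeakDeriv g g') {fa fb ga gb : ℂ} (hfa : HasValue f a fa) (hfb : HasValue f b fb)
    (hga : HasValue g a ga) (hgb : HasValue g b gb) :
    ⟪f', g⟫_ℂ + ⟪f, g'⟫_ℂ = star fb * gb - star fa * ga := by
  have hb := right_mem_Icc.2 hab.le
  have hfi : IntegrableOn (fun x => star (f' x)) (Ioo a b) :=
    (Complex.conjCLE : ℂ →L[ℝ] ℂ).integrable_comp (integrable_L2 f')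
  have key := integral_const_add_primitive hab.le hfi (integrable_L2 g') (star fa) ga
  have hconj (x : ℝ) : ∫ t in a..x, star (f' t) = star (∫ t in a..x, f' t) :=
    intervalIntegral.intervalIntegral_conj
  simp only [hconj, ← star_add] at key
  rw [← hf.value_eq hab hfa hb hfb, ← hg.value_eq hab hga hb hgb, add_comm] at key
  rw [← key, L2.inner_def, L2.inner_def]
  congr 1
  · refine integral_congr_ae ?_
    filter_upwards [hg.ae_eq_of_hasValue hab hga] with x hx
    rw [RCLike.inner_apply, hx, mul_comm]
    rfl
  · refine integral_congr_ae ?_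
    filter_upwards [hf.ae_eq_of_hasValue hab hfa] with x hx
    rw [RCLike.inner_apply, hx]
    rfl

/-! ### Multiplication by `x - c` -/

lemma memLp_mulWeight (c : ℝ) (f : L2 a b) :
    MemLp (fun x => (x - c) • f x) 2 (volume.restrict (Ioo a b)) := by
  refine MemLp.of_le_mul (c := |a - c| + |b - c|) (Lp.memLp f)
    ((by fun_prop : Continuous fun x : ℝ => x - c).aestronglyMeasurable.smul
      (Lp.aestronglyMeasurable f)) ?_
  filter_upwards [ae_restrict_mem measurableSet_Ioo] with x hx
  rw [norm_smul, Real.norm_eq_abs]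
  gcongr
  rw [abs_le]
  have := neg_abs_le (a - c)
  have := le_abs_self (b - c)
  have := abs_nonneg (a - c)
  have := abs_nonneg (b - c)
  have := hx.1
  have := hx.2
  constructor <;> linarith

/-- The product of an `L²` function with `x - c`. -/
def mulWeight (c : ℝ) (f : L2 a b) : L2 a b := (memLp_mulWeight c f).toLp _

lemma coeFn_mulWeight (c : ℝ) (f : L2 a b) :
    mulWeight c f =ᵐ[volume.restrict (Ioo a b)] fun x => (x - c) • f x :=
  (memLp_mulWeight c f).coeFn_toLp

lemma norm_mulWeight_le {c : ℝ} (ha : |a - c| ≤ 1) (hb : |b - c| ≤ 1) (f : L2 a b) :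
    ‖mulWeight c f‖ ≤ ‖f‖ := by
  refine Lp.norm_le_norm_of_ae_le ?_
  filter_upwards [coeFn_mulWeight c f, ae_restrict_mem measurableSet_Ioo] with x hx hxm
  rw [hx, norm_smul, Real.norm_eq_abs]
  have : |x - c| ≤ 1 := abs_le.2
    ⟨by linarith [(abs_le.1 ha).1, hxm.1], by linarith [(abs_le.1 hb).2, hxm.2]⟩
  exact mul_le_of_le_one_left (norm_nonneg _) this

lemma inner_mulWeight_left (c : ℝ) (f g : L2 a b) : ⟪mulWeight c f, g⟫_ℂ = ⟪f, mulWeight c g⟫_ℂ := by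
  rw [L2.inner_def, L2.inner_def]
  refine integral_congr_ae ?_
  filter_upwards [coeFn_mulWeight c f, coeFn_mulWeight c g] with x h1 h2
  rw [h1, h2, inner_smul_left_eq_smul, inner_smul_right_eq_smul]

lemma HasValue.mul_weight {f : L2 a b} {d : ℝ} {y : ℂ} (h : HasValue f d y) (c : ℝ) :
    HasValue (mulWeight c f) d ((d - c) • y) := by
  obtain ⟨F, h1, h2, rfl⟩ := h
  refine ⟨fun x => (x - c) • F x, by fun_prop, ?_, rfl⟩
  filter_upwards [h2, coeFn_mulWeight c f] with x e1 e2
  rw [e2, e1]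

lemma IsWeakDeriv.mul_weight {f g : L2 a b} (h : IsWeakDeriv f g) (c : ℝ) :
    IsWeakDeriv (mulWeight c f) (mulWeight c g + f) := by
  intro φ h1 h2 h3
  have hd : Continuous (deriv φ) := h1.continuous_deriv (by simp)
  let ψ : ℝ → ℝ := fun x => φ x * (x - c)
  have ψ1 : ContDiff ℝ ∞ ψ := h1.mul (contDiff_id.sub contDiff_const)
  have ψ2 : HasCompactSupport ψ := h2.mul_right
  have ψ3 : tsupport ψ ⊆ Ioo a b := (tsupport_mul_subset_left (f := φ)).trans h3
  have ψd (x : ℝ) : deriv ψ x = deriv φ x * (x - c) + φ x := by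
    have := ((h1.differentiable (by simp)).differentiableAt (x := x)).hasDerivAt.mul
      ((hasDerivAt_id x).sub_const c)
    exact this.deriv.trans (by simp)
  have key := h ψ ψ1 ψ2 ψ3
  have e1 : ∫ x in Ioo a b, deriv φ x • (mulWeight c f : L2 a b) x
      = (∫ x in Ioo a b, deriv ψ x • f x) - ∫ x in Ioo a b, φ x • f x := by
    rw [← integral_sub (integrable_smul_L2 f (ψ1.continuous_deriv (by simp)) ψ2.deriv)
      (integrable_smul_L2 f h1.continuous h2)]
    refine integral_congr_ae ?_
    filter_upwards [coeFn_mulWeight c f] with x hx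
    rw [hx, ψd, smul_smul, add_smul, add_sub_cancel_right]
  have e2 : ∫ x in Ioo a b, φ x • (mulWeight c g + f : L2 a b) x
      = (∫ x in Ioo a b, ψ x • g x) + ∫ x in Ioo a b, φ x • f x := by
    rw [← integral_add (integrable_smul_L2 g ψ1.continuous ψ2)
      (integrable_smul_L2 f h1.continuous h2)]
    refine integral_congr_ae ?_
    filter_upwards [coeFn_mulWeight c g, Lp.coeFn_add (mulWeight c g) f] with x hx hy
    rw [hy, Pi.add_apply, hx, smul_add, smul_smul]
  rw [e1, e2, key]
  ring

/-! ### Trace identities at the ends of a unit interval -/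

lemma re_inner_mulWeight_add (c : ℝ) (f g : L2 a b) :
    (⟪mulWeight c g + f, f⟫_ℂ + ⟪mulWeight c f, g⟫_ℂ).re
      = ‖f‖ ^ 2 + 2 * (⟪mulWeight c f, g⟫_ℂ).re := by
  have e : (⟪f, f⟫_ℂ).re = ‖f‖ ^ 2 := (norm_sq_eq_re_inner (𝕜 := ℂ) f).symm
  rw [inner_add_left, inner_mulWeight_left, ← inner_conj_symm g, Complex.add_re, Complex.add_re,
    Complex.conj_re, e]
  ring

lemma re_star_mul_self (y : ℂ) : (star y * y).re = ‖y‖ ^ 2 := by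
  rw [mul_comm, Complex.star_def, Complex.mul_conj, Complex.ofReal_re, Complex.normSq_eq_norm_sq]

/-- The trace identity at the right end of an interval of length one. -/
lemma IsWeakDeriv.sq_norm_right (hab : b = a + 1) {f g : L2 a b} (h : IsWeakDeriv f g) {y : ℂ}
    (hy : HasValue f b y) : ‖y‖ ^ 2 = ‖f‖ ^ 2 + 2 * (⟪mulWeight a f, g⟫_ℂ).re := by
  have hlt : a < b := by linarith
  obtain ⟨z, hz⟩ := h.exists_hasValue hlt a
  -- The weight `x - a` is 0 at `a` and 1 at `b`, so the unknown value `z` drops out.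
  have key := (h.mul_weight a).inner_add_inner hlt h (hz.mul_weight a) (hy.mul_weight a) hz hy
  rw [← re_inner_mulWeight_add, key, ← re_star_mul_self]
  simp [hab]

/-- The trace identity at the left end of an interval of length one. -/
lemma IsWeakDeriv.sq_norm_left (hab : b = a + 1) {f g : L2 a b} (h : IsWeakDeriv f g) {y : ℂ}
    (hy : HasValue f a y) : ‖y‖ ^ 2 = ‖f‖ ^ 2 + 2 * (⟪mulWeight b f, g⟫_ℂ).re := by
  have hlt : a < b := by linarith
  obtain ⟨z, hz⟩ := h.exists_hasValue hlt b
  -- The weight `x - b` is 0 at `b` and -1 at `a`; this sign cancels the minus sign of the boundary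
  -- term at `a`.
  have key := (h.mul_weight b).inner_add_inner hlt h (hy.mul_weight b) (hz.mul_weight b) hy hz
  rw [← re_inner_mulWeight_add, key, ← re_star_mul_self]
  simp [hab]

lemma re_inner_mulWeight_le {c : ℝ} (ha : |a - c| ≤ 1) (hb : |b - c| ≤ 1) (f g : L2 a b) :
    (⟪mulWeight c f, g⟫_ℂ).re ≤ ‖f‖ * ‖g‖ :=
  (re_inner_le_norm (𝕜 := ℂ) _ _).trans
    (mul_le_mul_of_nonneg_right (norm_mulWeight_le ha hb f) (norm_nonneg g))

lemma IsWeakDeriv.sq_norm_right_le (hab : b = a + 1) {f g : L2 a b} (h : IsWeakDeriv f g) {y : ℂ}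
    (hy : HasValue f b y) : ‖y‖ ^ 2 ≤ ‖f‖ ^ 2 + 2 * (‖f‖ * ‖g‖) := by
  rw [h.sq_norm_right hab hy]
  gcongr
  exact re_inner_mulWeight_le (by simp) (by simp [hab]) f g

lemma IsWeakDeriv.sq_norm_left_le (hab : b = a + 1) {f g : L2 a b} (h : IsWeakDeriv f g) {y : ℂ}
    (hy : HasValue f a y) : ‖y‖ ^ 2 ≤ ‖f‖ ^ 2 + 2 * (‖f‖ * ‖g‖) := by
  rw [h.sq_norm_left hab hy]
  gcongr
  exact re_inner_mulWeight_le (by simp [hab]) (by simp) f g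

/-! ### Poincaré inequalities -/

/-- On an interval of length one Lebesgue measure is a probability measure, so the `L¹` norm is at
most the `L²` norm. -/
lemma norm_intervalIntegral_le (hab : b = a + 1) (g : L2 a b) {x : ℝ} (hx : x ∈ Icc a b) :
    ‖∫ t in a..x, g t‖ ≤ ‖g‖ := by
  have : IsProbabilityMeasure (volume.restrict (Ioo a b)) := ⟨by simp [hab]⟩
  have hlt : a < b := by linarith
  have hg := integrable_L2 g
  calc ‖∫ t in a..x, g t‖ ≤ ∫ t in a..x, ‖g t‖ :=
        intervalIntegral.norm_integral_le_integral_norm hx.1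
    _ ≤ ∫ t in Ioo a b, ‖g t‖ := by
        rw [intervalIntegral.integral_of_le hx.1, ← integral_Ioc_eq_integral_Ioo]
        refine setIntegral_mono_set ?_ (Filter.Eventually.of_forall fun _ => norm_nonneg _)
          (Ioc_subset_Ioc_right hx.2).eventuallyLE
        exact (integrableOn_Ioc_iff_integrableOn_Ioo).2 hg.norm
    _ ≤ ‖g‖ := by
        rw [integral_norm_eq_lintegral_enorm hg.aestronglyMeasurable, Lp.norm_def,
          ← eLpNorm_one_eq_lintegral_enorm]
        exact ENNReal.toReal_mono (Lp.eLpNorm_ne_top g)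
          (eLpNorm_le_eLpNorm_of_exponent_le (by norm_num) hg.aestronglyMeasurable)

lemma IsWeakDeriv.norm_sub_le (hab : b = a + 1) {f g : L2 a b} (h : IsWeakDeriv f g) {y z : ℂ}
    (hy : HasValue f a y) (hz : HasValue f b z) : ‖z - y‖ ≤ ‖g‖ := by
  have hlt : a < b := by linarith
  rw [h.value_eq hlt hy (right_mem_Icc.2 hlt.le) hz, add_sub_cancel_left]
  exact norm_intervalIntegral_le hab g (right_mem_Icc.2 hlt.le)

lemma IsWeakDeriv.norm_le (hab : b = a + 1) {f g : L2 a b} (h : IsWeakDeriv f g) {y : ℂ}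
    (hy : HasValue f a y) : ‖f‖ ≤ ‖y‖ + ‖g‖ := by
  have : IsProbabilityMeasure (volume.restrict (Ioo a b)) := ⟨by simp [hab]⟩
  have hlt : a < b := by linarith
  have := Lp.norm_le_of_ae_bound (f := f) (add_nonneg (norm_nonneg y) (norm_nonneg g)) (by
    filter_upwards [h.ae_eq_of_hasValue hlt hy, ae_restrict_mem measurableSet_Ioo] with x hx hm
    rw [hx]
    exact (norm_add_le _ _).trans
      (add_le_add_right (norm_intervalIntegral_le hab g (Ioo_subset_Icc_self hm)) _))
  simpa [measureUnivNNReal] using this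

end sobolev

/-! ## A priori estimates -/

section waveheat

variable {a b : ℝ}

/-- The weight is real, so the two terms containing `s` add up to `is` times a number plus its
conjugate, which is purely imaginary. This makes the multiplier estimates for the waves uniform in
`s`. -/
lemma neg_le_re_inner_mulWeight_add {c : ℝ} (ha : |a - c| ≤ 1) (hb : |b - c| ≤ 1) (s : ℝ)
    (p v g k : L2 a b) :
    -(‖p‖ * ‖g‖ + ‖v‖ * ‖k‖)
      ≤ (⟪mulWeight c p, ((s : ℂ) * Complex.I) • v - g⟫_ℂ).re
        + (⟪mulWeight c v, ((s : ℂ) * Complex.I) • p - k⟫_ℂ).re := by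
  have h1 := re_inner_mulWeight_le ha hb p g
  have h2 := re_inner_mulWeight_le ha hb v k
  rw [inner_sub_right, inner_sub_right, inner_smul_right, inner_smul_right,
    inner_mulWeight_left c v p, ← inner_conj_symm v]
  simp only [Complex.sub_re, Complex.mul_re, Complex.conj_re, Complex.conj_im, Complex.mul_im,
    Complex.ofReal_re, Complex.ofReal_im, Complex.I_re, Complex.I_im]
  nlinarith

/-- The multiplier estimate for the wave equation with observation at the right end. -/
lemma wave_estimate_right (hab : b = a + 1) (s : ℝ) {p p' v v' g k : L2 a b}
    (hp : IsWeakDeriv p p') (hv : IsWeakDeriv v v') (hp' : p' = ((s : ℂ) * Complex.I) • v - g)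
    (hv' : v' = ((s : ℂ) * Complex.I) • p - k) {y z : ℂ} (hy : HasValue p b y)
    (hz : HasValue v b z) :
    ‖p‖ ^ 2 + ‖v‖ ^ 2 ≤ ‖y‖ ^ 2 + ‖z‖ ^ 2 + 2 * (‖p‖ * ‖g‖ + ‖v‖ * ‖k‖) := by
  have h1 := hp.sq_norm_right hab hy
  have h2 := hv.sq_norm_right hab hz
  have h3 := neg_le_re_inner_mulWeight_add (a := a) (b := b) (c := a) (by simp) (by simp [hab])
    s p v g k
  rw [← hp', ← hv'] at h3
  linarith

/-- The multiplier estimate for the wave equation with observation at the left end. -/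
lemma wave_estimate_left (hab : b = a + 1) (s : ℝ) {p p' v v' g k : L2 a b}
    (hp : IsWeakDeriv p p') (hv : IsWeakDeriv v v') (hp' : p' = ((s : ℂ) * Complex.I) • v - g)
    (hv' : v' = ((s : ℂ) * Complex.I) • p - k) {y z : ℂ} (hy : HasValue p a y)
    (hz : HasValue v a z) :
    ‖p‖ ^ 2 + ‖v‖ ^ 2 ≤ ‖y‖ ^ 2 + ‖z‖ ^ 2 + 2 * (‖p‖ * ‖g‖ + ‖v‖ * ‖k‖) := by
  have h1 := hp.sq_norm_left hab hy
  have h2 := hv.sq_norm_left hab hz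
  have h3 := neg_le_re_inner_mulWeight_add (a := a) (b := b) (c := b) (by simp [hab]) (by simp)
    s p v g k
  rw [← hp', ← hv'] at h3
  linarith

/-- The estimate obtained by testing the resolvent equation of the heat part with `w`. -/
lemma heat_estimate (hab : a < b) (s : ℝ) {w w' w'' h : L2 a b}
    (hw : IsWeakDeriv w w') (hw' : IsWeakDeriv w' w'') (hw'' : w'' = ((s : ℂ) * Complex.I) • w - h)
    {wa wb wa' wb' : ℂ} (ha : HasValue w a wa) (hb : HasValue w b wb) (ha' : HasValue w' a wa')
    (hb' : HasValue w' b wb') :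
    |s| * ‖w‖ ^ 2 ≤ ‖wb‖ * ‖wb'‖ + ‖wa‖ * ‖wa'‖ + ‖w‖ * ‖h‖ := by
  have key := hw.inner_add_inner hab hw' ha hb ha' hb'
  have e (f : L2 a b) : ⟪f, f⟫_ℂ = ((‖f‖ ^ 2 : ℝ) : ℂ) := by
    rw [inner_self_eq_norm_sq_to_K]
    norm_cast
  have h1 : (((s * ‖w‖ ^ 2 : ℝ) : ℂ) * Complex.I)
      = star wb * wb' - star wa * wa' - ((‖w'‖ ^ 2 : ℝ) : ℂ) + ⟪w, h⟫_ℂ := by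
    rw [← key, hw'', inner_sub_right, inner_smul_right, e, e]
    push_cast
    ring
  -- The imaginary part discards `‖w'‖²` and isolates `s ‖w‖²`.
  have h2 := congrArg Complex.im h1
  simp only [Complex.add_im, Complex.sub_im, Complex.ofReal_im, Complex.mul_I_im,
    Complex.ofReal_re, sub_zero] at h2
  have t1 := (Complex.abs_im_le_norm (star wb * wb'))
  have t2 := (Complex.abs_im_le_norm (star wa * wa'))
  have t3 := (Complex.abs_im_le_norm ⟪w, h⟫_ℂ).trans (norm_inner_le_norm w h)
  rw [norm_mul, norm_star] at t1 t2
  have : |s| * ‖w‖ ^ 2 = |s * ‖w‖ ^ 2| := by rw [abs_mul, abs_of_nonneg (sq_nonneg ‖w‖)]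
  rw [this, h2]
  refine (abs_add_le _ _).trans (add_le_add ((abs_sub _ _).trans (add_le_add t1 t2)) t3)

end waveheat

/-! ### Closing the system of scalar inequalities -/

/-- In the application `r = √|s|`, `X = ‖x‖`, `N = ‖F‖`, `W = ‖w‖`, `D = ‖w'‖`, and `B`, `b` bound
the traces of `w'` and `w`. With `e² = N X` and `t = r W`, if `e < t` then `B² b² ≲ e t³`, while the
heat inequality gives `t⁴ ≲ B² b² + e⁴`; so `t ≲ e` in every case. Inserting this in the last
hypothesis gives `X² ≲ (1 + r) e²`. The parameter `κ` keeps `r` away from 0, so that `1 + r ≲ r`. -/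
lemma resolvent_bound_of_pos {κ : ℝ} (hκ : 1 ≤ κ) : ∃ C : ℝ, 0 < C ∧ ∀ r X N W D B b : ℝ,
    0 < r → 1 ≤ κ * r → 0 ≤ X → 0 ≤ N → 0 ≤ W → 0 ≤ D → D ^ 2 ≤ N * X →
    B ^ 2 ≤ D ^ 2 + 2 * D * (r ^ 2 * W + N) → b ^ 2 ≤ W ^ 2 + 2 * W * D →
    r ^ 2 * W ^ 2 ≤ 2 * B * b + N * X →
    X ^ 2 ≤ 2 * B ^ 2 + 2 * b ^ 2 + 8 * (N * X) + W ^ 2 → X ≤ C * r * N := by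
  -- Here `122 = 8 * 15 + 2`: the factor 15 comes from `hBb`, the factors 8 and 2 from `h4`.
  obtain ⟨K, hK⟩ : ∃ K, K = 122 * κ ^ 2 := ⟨_, rfl⟩
  have hK0 : 0 < K := by rw [hK]; positivity
  refine ⟨(14 + 3 * κ ^ 2 * K ^ 2 + 4 * κ * K) * κ + 4 * K, by positivity, ?_⟩
  intro r X N W D B b hr hκr hX hN hW hD hDE hB hb hWE hXE
  -- When `X ≤ N` the claim is immediate from `1 ≤ κ * r`; otherwise `N ≤ e` and `X` can be
  -- cancelled at the end.
  rcases le_or_gt X N with hXN | hXN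
  · calc X ≤ N := hXN
      _ ≤ (κ * r) * N := le_mul_of_one_le_left hN hκr
      _ ≤ _ := by
        gcongr
        have : 0 ≤ (13 + 3 * κ ^ 2 * K ^ 2 + 4 * κ * K) * κ + 4 * K := by positivity
        linarith
  obtain ⟨e, he⟩ : ∃ e, e = √(N * X) := ⟨_, rfl⟩
  have he0 : 0 ≤ e := he ▸ Real.sqrt_nonneg _
  have he2 : e ^ 2 = N * X := by rw [he, Real.sq_sqrt (by positivity)]
  have hDe : D ≤ e := le_of_sq_le_sq (by rw [he2]; exact hDE) he0
  have hNe : N ≤ e := le_of_sq_le_sq (by rw [he2]; nlinarith) he0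
  rw [← he2] at hWE hXE
  obtain ⟨t, ht⟩ : ∃ t, t = r * W := ⟨_, rfl⟩
  have ht0 : 0 ≤ t := ht ▸ by positivity
  have hWt : W ≤ κ * t := by
    rw [ht, ← mul_assoc]
    exact le_mul_of_one_le_left hW hκr
  have hB1 : B ^ 2 ≤ 3 * e ^ 2 + 2 * e * (r * t) := by
    have h1 : D ^ 2 ≤ e ^ 2 := by gcongr
    have h2 : 2 * D * (r ^ 2 * W + N) ≤ 2 * e * (r * t + e) := by
      have : r ^ 2 * W = r * t := by rw [ht]; ring
      rw [this]
      gcongr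
    nlinarith
  have hb1 : b ^ 2 ≤ W ^ 2 + 2 * W * e := hb.trans (by gcongr)
  have hte : t ≤ K * e := by
    by_contra! hlt
    have hKe : e ≤ K * e := le_mul_of_one_le_left he0 (by
      rw [hK]
      linarith [one_le_pow₀ hκ (n := 2)])
    have het : e < t := hKe.trans_lt hlt
    have htp : 0 < t := he0.trans_lt het
    have hBb : B ^ 2 * b ^ 2 ≤ 15 * κ ^ 2 * (e * t ^ 3) := by
      calc B ^ 2 * b ^ 2 ≤ (3 * e ^ 2 + 2 * e * (r * t)) * (W ^ 2 + 2 * W * e) := by gcongr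
        _ = 3 * e ^ 2 * W ^ 2 + 6 * e ^ 3 * W + 2 * e * t ^ 2 * W + 4 * e ^ 2 * t ^ 2 := by
          rw [ht]; ring
        _ ≤ 3 * e ^ 2 * (κ * t) ^ 2 + 6 * e ^ 3 * (κ * t) + 2 * e * t ^ 2 * (κ * t)
            + 4 * e ^ 2 * t ^ 2 := by gcongr
        _ = e * (3 * κ ^ 2 * (e * t ^ 2) + 6 * κ * (e ^ 2 * t) + 2 * κ * t ^ 3
            + 4 * (e * t ^ 2)) := by ring
        _ ≤ e * (3 * κ ^ 2 * (t * t ^ 2) + 6 * κ ^ 2 * (t ^ 2 * t) + 2 * κ ^ 2 * t ^ 3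
            + 4 * κ ^ 2 * (t * t ^ 2)) := by
          have h1 : κ ≤ κ ^ 2 := le_self_pow₀ hκ two_ne_zero
          have h2 : 1 ≤ κ ^ 2 := one_le_pow₀ hκ
          have h3 : 4 * (e * t ^ 2) ≤ 4 * κ ^ 2 * (t * t ^ 2) := by
            calc 4 * (e * t ^ 2) ≤ 4 * (t * t ^ 2) := by gcongr
              _ ≤ 4 * κ ^ 2 * (t * t ^ 2) := by
                gcongr
                linarith
          gcongr
        _ = 15 * κ ^ 2 * (e * t ^ 3) := by ring
    have h4 : (r ^ 2 * W ^ 2) ^ 2 ≤ 8 * (B ^ 2 * b ^ 2) + 2 * e ^ 4 := by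
      calc (r ^ 2 * W ^ 2) ^ 2 ≤ (2 * B * b + e ^ 2) ^ 2 := by gcongr
        _ ≤ 8 * (B ^ 2 * b ^ 2) + 2 * e ^ 4 := by nlinarith [sq_nonneg (2 * B * b - e ^ 2)]
    have h5 : e ^ 4 ≤ e * t ^ 3 := by
      calc e ^ 4 = e * e ^ 3 := by ring
        _ ≤ e * t ^ 3 := by gcongr
    have h6 : t ^ 4 ≤ K * e * t ^ 3 := by
      have : t ^ 4 = (r ^ 2 * W ^ 2) ^ 2 := by rw [ht]; ring
      rw [this, hK]
      have h8 : 1 * (e * t ^ 3) ≤ κ ^ 2 * (e * t ^ 3) := by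
        gcongr
        exact one_le_pow₀ hκ
      linarith
    have h7 : K * e * t ^ 3 < t * t ^ 3 := by gcongr
    linarith [(by ring : t * t ^ 3 = t ^ 4)]
  have hWe : W ≤ κ * (K * e) := hWt.trans (by gcongr)
  have hX2 : X * X ≤ ((14 + 3 * κ ^ 2 * K ^ 2 + 4 * κ * K) * κ + 4 * K) * r * N * X := by
    have h1 : B ^ 2 ≤ 3 * e ^ 2 + 2 * e * (r * (K * e)) := hB1.trans (by gcongr)
    have h2 : W ^ 2 ≤ (κ * (K * e)) ^ 2 := by gcongr
    have h3 : b ^ 2 ≤ (κ * (K * e)) ^ 2 + 2 * (κ * (K * e)) * e := hb1.trans (by gcongr)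
    calc X * X = X ^ 2 := by ring
      _ ≤ (14 + 3 * κ ^ 2 * K ^ 2 + 4 * κ * K) * e ^ 2 * 1 + 4 * K * r * e ^ 2 := by linarith
      _ ≤ (14 + 3 * κ ^ 2 * K ^ 2 + 4 * κ * K) * e ^ 2 * (κ * r) + 4 * K * r * e ^ 2 := by gcongr
      _ = _ := by rw [he2]; ring
  exact le_of_mul_le_mul_right hX2 (hN.trans_lt hXN)

/-- At `s = 0` the heat inequality says nothing about `W`, and `W ≤ N + D` replaces it. With `e² = N
X` and `N < X`, this gives `W ≤ 2e`, `B² ≤ 3e²`, `b² ≤ 8e²`, and `34 = 2 * 3 + 2 * 8 + 8 + 4`. -/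
lemma resolvent_bound_zero {X N W D B b : ℝ} (hX : 0 ≤ X) (hN : 0 ≤ N) (hW : 0 ≤ W)
    (hD : 0 ≤ D) (hDE : D ^ 2 ≤ N * X) (hB : B ^ 2 ≤ D ^ 2 + 2 * D * N)
    (hb : b ^ 2 ≤ W ^ 2 + 2 * W * D) (hWE : W ≤ N + D)
    (hXE : X ^ 2 ≤ 2 * B ^ 2 + 2 * b ^ 2 + 8 * (N * X) + W ^ 2) : X ≤ 34 * N := by
  rcases le_or_gt X N with hXN | hXN
  · linarith
  obtain ⟨e, he⟩ : ∃ e, e = √(N * X) := ⟨_, rfl⟩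
  have he0 : 0 ≤ e := he ▸ Real.sqrt_nonneg _
  have he2 : e ^ 2 = N * X := by rw [he, Real.sq_sqrt (by positivity)]
  have hDe : D ≤ e := le_of_sq_le_sq (by rw [he2]; exact hDE) he0
  have hNe : N ≤ e := le_of_sq_le_sq (by rw [he2]; nlinarith) he0
  have hWe : W ≤ 2 * e := by linarith
  have h1 : B ^ 2 ≤ e ^ 2 + 2 * e * e := hB.trans (by gcongr)
  have h2 : b ^ 2 ≤ (2 * e) ^ 2 + 2 * (2 * e) * e := hb.trans (by gcongr)
  have h3 : W ^ 2 ≤ (2 * e) ^ 2 := by gcongr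
  have hX2 : X * X ≤ 34 * N * X := by nlinarith
  exact le_of_mul_le_mul_right hX2 (hN.trans_lt hXN)

/-! ### The resolvent equation and its estimates -/

namespace State

@[simp] lemma sub_u (x y : State) : (x - y).u = x.u - y.u := by
  change x.u + (-1 : ℂ) • y.u = _
  rw [neg_one_smul, sub_eq_add_neg]

@[simp] lemma sub_v (x y : State) : (x - y).v = x.v - y.v := by
  change x.v + (-1 : ℂ) • y.v = _
  rw [neg_one_smul, sub_eq_add_neg]

@[simp] lemma sub_w (x y : State) : (x - y).w = x.w - y.w := by
  change x.w + (-1 : ℂ) • y.w = _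
  rw [neg_one_smul, sub_eq_add_neg]

@[simp] lemma sub_ut (x y : State) : (x - y).ut = x.ut - y.ut := by
  change x.ut + (-1 : ℂ) • y.ut = _
  rw [neg_one_smul, sub_eq_add_neg]

@[simp] lemma sub_vt (x y : State) : (x - y).vt = x.vt - y.vt := by
  change x.vt + (-1 : ℂ) • y.vt = _
  rw [neg_one_smul, sub_eq_add_neg]

lemma inner_eq (x y : State) : ⟪x, y⟫_ℂ = ⟪wderiv x.u, wderiv y.u⟫_ℂ + ⟪x.v, y.v⟫_ℂ
    + ⟪x.w, y.w⟫_ℂ + ⟪wderiv x.ut, wderiv y.ut⟫_ℂ + ⟪x.vt, y.vt⟫_ℂ := rfl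

lemma norm_components_le (x : State) : ‖wderiv x.u‖ ≤ ‖x‖ ∧ ‖x.v‖ ≤ ‖x‖ ∧ ‖x.w‖ ≤ ‖x‖ ∧
    ‖wderiv x.ut‖ ≤ ‖x‖ ∧ ‖x.vt‖ ≤ ‖x‖ := by
  have h := norm_sq_eq x
  have h1 := sq_nonneg ‖wderiv x.u‖
  have h2 := sq_nonneg ‖x.v‖
  have h3 := sq_nonneg ‖x.w‖
  have h4 := sq_nonneg ‖wderiv x.ut‖
  have h5 := sq_nonneg ‖x.vt‖
  refine ⟨?_, ?_, ?_, ?_, ?_⟩ <;> refine le_of_sq_le_sq ?_ (norm_nonneg x) <;> linarith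

end State

/-- The components of `F = (is - A) x` written as first-order equations. -/
structure ResolventEquation (s : ℝ) (x F : State) : Prop where
  deriv_p : IsWeakDeriv (wderiv x.u) (((s : ℂ) * Complex.I) • x.v - F.v)
  deriv_v : IsWeakDeriv x.v (((s : ℂ) * Complex.I) • wderiv x.u - wderiv F.u)
  deriv_w : IsWeakDeriv x.w (wderiv x.w)
  deriv_dw : IsWeakDeriv (wderiv x.w) (((s : ℂ) * Complex.I) • x.w - F.w)
  deriv_pt : IsWeakDeriv (wderiv x.ut) (((s : ℂ) * Complex.I) • x.vt - F.vt)
  deriv_vt : IsWeakDeriv x.vt (((s : ℂ) * Complex.I) • wderiv x.ut - wderiv F.ut)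

lemma resolventEquation (s : ℝ) (x : genDomain) :
    ResolventEquation s x.1 (((s : ℂ) * Complex.I) • x.1 - generator x) := by
  have hx := x.2
  have hA : generator x = genFun x := rfl
  refine ⟨?_, ?_, hx.2.2.1.1.isWeakDeriv, ?_, ?_, ?_⟩
  · simpa [hA] using hx.1.2.isWeakDeriv
  -- The first component is `F.u = is u - v`; its derivative expresses `v'` through `u'` and `F.u'`.
  · rw [State.sub_u, State.smul_u, hA, genFun_u,
      ((hx.1.1.isWeakDeriv.smul _).sub hx.2.1.isWeakDeriv).wderiv_eq, sub_sub_cancel]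
    exact hx.2.1.isWeakDeriv
  · simpa [hA] using hx.2.2.1.2.isWeakDeriv
  · simpa [hA] using hx.2.2.2.1.2.isWeakDeriv
  · rw [State.sub_ut, State.smul_ut, hA, genFun_ut,
      ((hx.2.2.2.1.1.isWeakDeriv.smul _).sub hx.2.2.2.2.1.isWeakDeriv).wderiv_eq, sub_sub_cancel]
    exact hx.2.2.2.2.1.isWeakDeriv

/-- The dissipation identity. -/
lemma re_inner_resolventEquation {s : ℝ} {x F : State} (h : ResolventEquation s x F)
    (v0 : HasValue x.v 0 0) (vt3 : HasValue x.vt 3 0) {y1 z1 y2 z2 : ℂ}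
    (p1 : HasValue (wderiv x.u) 1 y1) (dw1 : HasValue (wderiv x.w) 1 y1)
    (v1 : HasValue x.v 1 z1) (w1 : HasValue x.w 1 z1)
    (pt2 : HasValue (wderiv x.ut) 2 y2) (dw2 : HasValue (wderiv x.w) 2 y2)
    (vt2 : HasValue x.vt 2 z2) (w2 : HasValue x.w 2 z2) :
    (⟪x, F⟫_ℂ).re = ‖wderiv x.w‖ ^ 2 := by
  obtain ⟨y0, p0⟩ := h.deriv_p.exists_hasValue (by norm_num) 0
  obtain ⟨y3, pt3⟩ := h.deriv_pt.exists_hasValue (by norm_num) 3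
  -- The boundary terms at 0 and 3 vanish with the velocities. Those at 1 and 2 appear once from a
  -- wave and once from the heat part, with opposite real parts, because the traces are shared.
  have i1 := h.deriv_p.inner_add_inner (by norm_num) h.deriv_v p0 p1 v0 v1
  have i2 := h.deriv_w.inner_add_inner (by norm_num) h.deriv_dw w1 w2 dw1 dw2
  have i3 := h.deriv_pt.inner_add_inner (by norm_num) h.deriv_vt pt2 pt3 vt2 vt3
  have e {a b : ℝ} (f : L2 a b) : ⟪f, f⟫_ℂ = ((‖f‖ ^ 2 : ℝ) : ℂ) := by
    rw [inner_self_eq_norm_sq_to_K]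
    norm_cast
  rw [← inner_conj_symm] at i1 i3
  rw [e] at i2
  simp only [inner_sub_right, inner_smul_right, e] at i1 i2 i3
  have j1 := congrArg Complex.re i1
  have j2 := congrArg Complex.re i2
  have j3 := congrArg Complex.re i3
  rw [State.inner_eq]
  simp only [Complex.add_re, Complex.sub_re, Complex.mul_re, Complex.mul_im, Complex.conj_re,
    Complex.conj_im, Complex.ofReal_re, Complex.ofReal_im, Complex.I_re, Complex.I_im,
    Complex.star_def, mul_zero, zero_mul, sub_zero, mul_one, add_zero, zero_sub,
    Complex.neg_re] at j1 j2 j3 ⊢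
  linarith

/-- The estimates satisfied by a solution of the resolvent equation; here `D` stands for
`‖w'‖`, `W` for `‖w‖`, and `B`, `b` bound the traces of `w'` and `w`. -/
lemma exists_estimates (s : ℝ) (x : genDomain) {F : State}
    (hF : F = ((s : ℂ) * Complex.I) • x.1 - generator x) :
    ∃ W D B b : ℝ, 0 ≤ W ∧ 0 ≤ D ∧ D ^ 2 ≤ ‖F‖ * ‖x.1‖ ∧
      B ^ 2 ≤ D ^ 2 + 2 * D * (|s| * W + ‖F‖) ∧ b ^ 2 ≤ W ^ 2 + 2 * W * D ∧
      |s| * W ^ 2 ≤ 2 * B * b + ‖F‖ * ‖x.1‖ ∧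
      ‖x.1‖ ^ 2 ≤ 2 * B ^ 2 + 2 * b ^ 2 + 8 * (‖F‖ * ‖x.1‖) + W ^ 2 ∧
      (s = 0 → W ≤ ‖F‖ + D) := by
  have h : ResolventEquation s x.1 F := hF ▸ resolventEquation s x
  obtain ⟨_, _, _, _, _, v0, vt3, ⟨y1, p1, dw1⟩, ⟨z1, v1, w1⟩, ⟨y2, pt2, dw2⟩, ⟨z2, vt2, w2⟩⟩ := x.2
  obtain ⟨x, hx⟩ := x
  dsimp only at h v0 vt3 p1 dw1 v1 w1 pt2 dw2 vt2 w2 ⊢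
  have hE := re_inner_resolventEquation h v0 vt3 p1 dw1 v1 w1 pt2 dw2 vt2 w2
  obtain ⟨F1, F2, F3, F4, F5⟩ := State.norm_components_le F
  obtain ⟨X1, X2, X3, X4, X5⟩ := State.norm_components_le x
  have hx := norm_nonneg x
  have hFn := norm_nonneg F
  set W := ‖x.w‖ with hW
  set D := ‖wderiv x.w‖ with hD
  have hW0 : 0 ≤ W := norm_nonneg _
  have hD0 : 0 ≤ D := norm_nonneg _
  have hBpos : 0 ≤ D ^ 2 + 2 * D * (|s| * W + ‖F‖) := by positivity
  have hbpos : 0 ≤ W ^ 2 + 2 * W * D := by positivity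
  have hw'' : ‖((s : ℂ) * Complex.I) • x.w - F.w‖ ≤ |s| * W + ‖F‖ := by
    refine (norm_sub_le _ _).trans (add_le_add ?_ F3)
    rw [norm_smul, norm_mul, Complex.norm_I, mul_one, Complex.norm_real, Real.norm_eq_abs]
  have by1 : ‖y1‖ ^ 2 ≤ D ^ 2 + 2 * D * (|s| * W + ‖F‖) := by
    refine (h.deriv_dw.sq_norm_left_le (by norm_num) dw1).trans ?_
    rw [mul_assoc]
    gcongr
  have by2 : ‖y2‖ ^ 2 ≤ D ^ 2 + 2 * D * (|s| * W + ‖F‖) := by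
    refine (h.deriv_dw.sq_norm_right_le (by norm_num) dw2).trans ?_
    rw [mul_assoc]
    gcongr
  have bz1 : ‖z1‖ ^ 2 ≤ W ^ 2 + 2 * W * D := by
    rw [mul_assoc]
    exact h.deriv_w.sq_norm_left_le (by norm_num) w1
  have bz2 : ‖z2‖ ^ 2 ≤ W ^ 2 + 2 * W * D := by
    rw [mul_assoc]
    exact h.deriv_w.sq_norm_right_le (by norm_num) w2
  -- Taking `B` and `b` to be the trace bounds themselves makes one pair serve both interfaces.
  refine ⟨W, D, √(D ^ 2 + 2 * D * (|s| * W + ‖F‖)), √(W ^ 2 + 2 * W * D), hW0, hD0, ?_,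
    (Real.sq_sqrt hBpos).le, (Real.sq_sqrt hbpos).le, ?_, ?_, ?_⟩
  · rw [← hE, mul_comm]
    exact re_inner_le_norm (𝕜 := ℂ) x F
  · have := heat_estimate (by norm_num) s h.deriv_w h.deriv_dw rfl w1 w2 dw1 dw2
    refine this.trans ?_
    calc ‖z2‖ * ‖y2‖ + ‖z1‖ * ‖y1‖ + ‖x.w‖ * ‖F.w‖
        ≤ √(W ^ 2 + 2 * W * D) * √(D ^ 2 + 2 * D * (|s| * W + ‖F‖))
          + √(W ^ 2 + 2 * W * D) * √(D ^ 2 + 2 * D * (|s| * W + ‖F‖)) + ‖x‖ * ‖F‖ := by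
          gcongr
          exacts [Real.le_sqrt_of_sq_le bz2, Real.le_sqrt_of_sq_le by2,
            Real.le_sqrt_of_sq_le bz1, Real.le_sqrt_of_sq_le by1]
      _ = _ := by ring
  · rw [Real.sq_sqrt hBpos, Real.sq_sqrt hbpos, State.norm_sq_eq]
    have e1 := wave_estimate_right (by norm_num) s h.deriv_p h.deriv_v rfl rfl p1 v1
    have e2 := wave_estimate_left (by norm_num) s h.deriv_pt h.deriv_vt rfl rfl pt2 vt2
    have m1 : ‖wderiv x.u‖ * ‖F.v‖ ≤ ‖x‖ * ‖F‖ := by gcongr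
    have m2 : ‖x.v‖ * ‖wderiv F.u‖ ≤ ‖x‖ * ‖F‖ := by gcongr
    have m3 : ‖wderiv x.ut‖ * ‖F.vt‖ ≤ ‖x‖ * ‖F‖ := by gcongr
    have m4 : ‖x.vt‖ * ‖wderiv F.ut‖ ≤ ‖x‖ * ‖F‖ := by gcongr
    linarith
  · rintro rfl
    -- For `s = 0` the equation reads `v' = -F.u'` with `v(0) = 0`; this bounds `v(1) = w(1)`, from
    -- which `w` is integrated.
    have hz := h.deriv_v.norm_sub_le (by norm_num) v0 v1
    have hw := h.deriv_w.norm_le (by norm_num) w1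
    rw [sub_zero, Complex.ofReal_zero, zero_mul, zero_smul, zero_sub, norm_neg] at hz
    linarith

/-! ### Lower bounds for `is - A` -/

/-- With `κ = 1` this is the uniform estimate for `|s| ≥ 1`; larger `κ` reach any fixed `s ≠ 0`, at
the price of a larger constant. -/
lemma norm_le_of_one_le_mul_sqrt {κ : ℝ} (hκ : 1 ≤ κ) : ∃ C : ℝ, 0 < C ∧
    ∀ (s : ℝ) (x : genDomain), 1 ≤ κ * √|s| →
      ‖x.1‖ ≤ C * √|s| * ‖((s : ℂ) * Complex.I) • x.1 - generator x‖ := by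
  obtain ⟨C, hC, H⟩ := resolvent_bound_of_pos hκ
  refine ⟨C, hC, fun s x hs => ?_⟩
  obtain ⟨W, D, B, b, h1, h2, h3, h4, h5, h6, h7, -⟩ := exists_estimates s x rfl
  have hr : 0 < √|s| := by
    by_contra hr
    nlinarith [Real.sqrt_nonneg |s|]
  have hrs : √|s| ^ 2 = |s| := Real.sq_sqrt (abs_nonneg s)
  exact H _ _ _ W D B b hr hs (norm_nonneg _) (norm_nonneg _) h1 h2 h3 (by rwa [hrs]) h5
    (by rwa [hrs]) h7

lemma norm_le_norm_generator (x : genDomain) : ‖x.1‖ ≤ 34 * ‖generator x‖ := by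
  have key : ((0 : ℝ) : ℂ) * Complex.I = 0 := by simp
  obtain ⟨W, D, B, b, h1, h2, h3, h4, h5, -, h7, h8⟩ := exists_estimates 0 x rfl
  rw [key, zero_smul, zero_sub, norm_neg] at *
  rw [abs_zero, zero_mul, zero_add] at h4
  exact resolvent_bound_zero (norm_nonneg _) (norm_nonneg _) h1 h2 h3 h4 h5 (h8 rfl) h7

/-- `is - A` is bounded below for every real `s`. -/
lemma exists_norm_le (s : ℝ) : ∃ C : ℝ, 0 < C ∧ ∀ x : genDomain,
    ‖x.1‖ ≤ C * ‖((s : ℂ) * Complex.I) • x.1 - generator x‖ := by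
  rcases eq_or_ne s 0 with rfl | hs
  · refine ⟨34, by norm_num, fun x => ?_⟩
    simpa using norm_le_norm_generator x
  · have hr : 0 < √|s| := Real.sqrt_pos.2 (abs_pos.2 hs)
    obtain ⟨C, hC, H⟩ := norm_le_of_one_le_mul_sqrt (κ := max 1 (√|s|)⁻¹) (le_max_left _ _)
    refine ⟨C * √|s|, by positivity, fun x => H s x ?_⟩
    calc 1 = (√|s|)⁻¹ * √|s| := (inv_mul_cancel₀ hr.ne').symm
      _ ≤ _ := by
        gcongr
        exact le_max_right _ _

/-! ## Completeness of the energy space -/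

namespace State

/-- The components `(u', v, w, ũ', ṽ)` of a state. -/
def energyComponents : State →ₗ[ℂ] L2 0 1 × L2 0 1 × L2 1 2 × L2 2 3 × L2 2 3 where
  toFun x := (wderiv x.u, x.v, x.w, wderiv x.ut, x.vt)
  map_add' x y := by simp [wderiv_add x.memH1_u y.memH1_u, wderiv_add x.memH1_ut y.memH1_ut]
  map_smul' c x := by simp [wderiv_smul c x.memH1_u, wderiv_smul c x.memH1_ut]

lemma norm_energyComponents_le (x : State) : ‖energyComponents x‖ ≤ 1 * ‖x‖ := by
  obtain ⟨h1, h2, h3, h4, h5⟩ := norm_components_le x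
  rw [one_mul]
  exact norm_prod_le_iff.2 ⟨h1, norm_prod_le_iff.2 ⟨h2, norm_prod_le_iff.2
    ⟨h3, norm_prod_le_iff.2 ⟨h4, h5⟩⟩⟩⟩

lemma norm_le_norm_energyComponents (x : State) : ‖x‖ ≤ (3 : NNReal) * ‖energyComponents x‖ := by
  obtain ⟨h1, h'⟩ := norm_prod_le_iff.1 (le_refl ‖energyComponents x‖)
  obtain ⟨h2, h'⟩ := norm_prod_le_iff.1 h'
  obtain ⟨h3, h'⟩ := norm_prod_le_iff.1 h'
  obtain ⟨h4, h5⟩ := norm_prod_le_iff.1 h'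
  refine le_of_sq_le_sq ?_ (by positivity)
  have hN := norm_nonneg (energyComponents x)
  rw [norm_sq_eq]
  calc _ ≤ ‖energyComponents x‖ ^ 2 + ‖energyComponents x‖ ^ 2 + ‖energyComponents x‖ ^ 2
        + ‖energyComponents x‖ ^ 2 + ‖energyComponents x‖ ^ 2 := by
        gcongr
        exacts [h1, h2, h3, h4, h5]
    _ ≤ _ := by
        rw [mul_pow]
        have : ((3 : NNReal) : ℝ) ^ 2 = 9 := by norm_num
        rw [this]
        nlinarith [sq_nonneg ‖energyComponents x‖]

/-- The displacements are recovered from their derivatives by integrating from the clamped ends 0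
and 3. -/
lemma energyComponents_surjective : Function.Surjective energyComponents := by
  rintro ⟨p, v, w, pt, vt⟩
  obtain ⟨u, hu, hu0⟩ := exists_isWeakDeriv zero_le_one p 0 0
  obtain ⟨ut, hut, hut0⟩ := exists_isWeakDeriv (by norm_num) pt 3 0
  refine ⟨⟨u, v, w, ut, vt, ⟨p, hu⟩, ⟨pt, hut⟩, hu0, hut0⟩, ?_⟩
  simp only [energyComponents, LinearMap.coe_mk, AddHom.coe_mk, hu.wderiv_eq, hut.wderiv_eq]

/-- `energyComponents` is a bi-Lipschitz bijection onto a product of `L²` spaces. -/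
instance : CompleteSpace State := by
  have h : IsUniformInducing energyComponents :=
    (AddMonoidHomClass.antilipschitz_of_bound energyComponents
      norm_le_norm_energyComponents).isUniformInducing
      (energyComponents.mkContinuous 1 norm_energyComponents_le).uniformContinuous
  exact (h.completeSpace_congr energyComponents_surjective).2 inferInstance

end State

/-! ## The resolvent at zero -/

/-- The function `l` is `x - a`; it corrects the value of a function at `b` without changing its
value at `a` or its second derivative. -/
lemma exists_affine {a b : ℝ} (hab : b = a + 1) : ∃ e l : L2 a b, IsWeakDeriv e 0 ∧
    IsWeakDeriv l e ∧ HasValue l a 0 ∧ HasValue l b 1 := by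
  have hlt : a < b := by linarith
  obtain ⟨e, he, hea⟩ := exists_isWeakDeriv hlt.le (0 : L2 a b) a 1
  obtain ⟨z, hz⟩ := he.exists_hasValue hlt b
  have hz1 : z = 1 := by
    have := he.norm_sub_le hab hea hz
    rw [norm_zero, norm_le_zero_iff, sub_eq_zero] at this
    exact this
  have h0 : mulWeight a (0 : L2 a b) = 0 := by
    apply Lp.ext
    filter_upwards [coeFn_mulWeight a (0 : L2 a b),
      Lp.coeFn_zero ℂ 2 (volume.restrict (Ioo a b))] with x h1 h2
    rw [h1, h2, Pi.zero_apply, smul_zero]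
  refine ⟨e, mulWeight a e, he, ?_, ?_, ?_⟩
  · simpa [h0] using he.mul_weight a
  · simpa using hea.mul_weight a
  · simpa [hab, hz1] using hz.mul_weight a

lemma MemH2.of_isWeakDeriv {a b : ℝ} {f g h : L2 a b} (hf : IsWeakDeriv f g)
    (hg : IsWeakDeriv g h) : MemH2 f :=
  ⟨⟨g, hf⟩, by rw [hf.wderiv_eq]; exact ⟨h, hg⟩⟩

/-- The system decouples. The velocities are `y.u` and `y.ut`, so `w` solves a Dirichlet problem
with their interface values. Its end slopes then prescribe `u'(1)` and `ũ'(2)`, and the waves follow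
by two integrations each. -/
lemma generator_surjective (y : State) : ∃ x : genDomain, generator x = y := by
  obtain ⟨α, hα⟩ := y.memH1_u.isWeakDeriv.exists_hasValue (by norm_num) 1
  obtain ⟨β, hβ⟩ := y.memH1_ut.isWeakDeriv.exists_hasValue (by norm_num) 2
  obtain ⟨d, hd, -⟩ := exists_isWeakDeriv (by norm_num) y.w 1 0
  obtain ⟨w, hw, hw1⟩ := exists_isWeakDeriv (by norm_num) d 1 α
  obtain ⟨γ, hγ⟩ := hw.exists_hasValue (by norm_num) 2
  obtain ⟨e, l, he, hl, hl1, hl2⟩ := exists_affine (a := 1) (b := 2) (by norm_num)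
  -- The function `w` has the right value `α` at 1 but `γ` at 2; adding `(β - γ) • l` changes the
  -- latter to `β`.
  have hd' : IsWeakDeriv (d + (β - γ) • e) y.w := by simpa using hd.add (he.smul (β - γ))
  have hw' : IsWeakDeriv (w + (β - γ) • l) (d + (β - γ) • e) := hw.add (hl.smul (β - γ))
  have hw1' : HasValue (w + (β - γ) • l) 1 α := by simpa using hw1.add (hl1.smul (β - γ))
  have hw2' : HasValue (w + (β - γ) • l) 2 β := by simpa using hγ.add (hl2.smul (β - γ))
  obtain ⟨y1, hy1⟩ := hd'.exists_hasValue (by norm_num) 1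
  obtain ⟨y2, hy2⟩ := hd'.exists_hasValue (by norm_num) 2
  obtain ⟨p, hp, hp1⟩ := exists_isWeakDeriv (by norm_num) y.v 1 y1
  obtain ⟨u, hu, hu0⟩ := exists_isWeakDeriv (by norm_num) p 0 0
  obtain ⟨pt, hpt, hpt2⟩ := exists_isWeakDeriv (by norm_num) y.vt 2 y2
  obtain ⟨ut, hut, hut3⟩ := exists_isWeakDeriv (by norm_num) pt 3 0
  let x : State := ⟨u, y.u, w + (β - γ) • l, ut, y.ut, ⟨p, hu⟩, ⟨pt, hut⟩, hu0, hut3⟩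
  have hx : x ∈ genDomain := by
    refine ⟨.of_isWeakDeriv hu hp, y.memH1_u, .of_isWeakDeriv hw' hd', .of_isWeakDeriv hut hpt,
      y.memH1_ut, y.value_u, y.value_ut, ⟨y1, ?_, ?_⟩, ⟨α, hα, hw1'⟩, ⟨y2, ?_, ?_⟩, ⟨β, hβ, hw2'⟩⟩
    · exact hu.wderiv_eq ▸ hp1
    · exact hw'.wderiv_eq ▸ hy1
    · exact hut.wderiv_eq ▸ hpt2
    · exact hw'.wderiv_eq ▸ hy2
  refine ⟨⟨x, hx⟩, State.ext rfl ?_ ?_ rfl ?_⟩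
  · change wderiv (wderiv u) = y.v
    rw [hu.wderiv_eq, hp.wderiv_eq]
  · change wderiv (wderiv (w + (β - γ) • l)) = y.w
    rw [hw'.wderiv_eq, hd'.wderiv_eq]
  · change wderiv (wderiv ut) = y.vt
    rw [hut.wderiv_eq, hpt.wderiv_eq]

/-! ## Resolvents along the imaginary axis -/

section continuation

variable {E : Type*} [NormedAddCommGroup E] [NormedSpace ℂ E]

lemma exists_isResolvent_zero (A : E →ₗ.[ℂ] E) {C : ℝ} (hA : ∀ y, ∃ x : A.domain, A x = y)
    (hC : ∀ x : A.domain, ‖(x : E)‖ ≤ C * ‖A x‖) : ∃ R : E →L[ℂ] E, IsResolvent A 0 R := by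
  have hinj : Function.Injective A.toFun := by
    refine (injective_iff_map_eq_zero _).2 fun x hx => ?_
    have h := hC x
    rw [show A x = 0 from hx, norm_zero, mul_zero, norm_le_zero_iff] at h
    exact Subtype.ext h
  let e : A.domain ≃ₗ[ℂ] E := LinearEquiv.ofBijective A.toFun ⟨hinj, hA⟩
  have he (y : E) : A (e.symm y) = y := e.apply_symm_apply y
  let R : E →L[ℂ] E := (-(A.domain.subtype ∘ₗ e.symm.toLinearMap)).mkContinuous C fun y => by
    have := hC (e.symm y)
    rw [he] at this
    simpa using this
  have hR (y : E) : R y = ((-e.symm y : A.domain) : E) := rfl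
  refine ⟨R, fun y => ⟨(-e.symm y).2, ?_⟩, fun x => ?_⟩
  · change (0 : ℂ) • R y - A (-e.symm y) = y
    rw [A.map_neg, he, zero_smul, zero_sub, neg_neg]
  · rw [hR, zero_smul, zero_sub, map_neg, neg_neg]
    exact congrArg _ (e.symm_apply_apply x)

lemma norm_resolventOp_le {A : E →ₗ.[ℂ] E} {z : ℂ} (hz : z ∈ resolventSet A) {M : ℝ} (hM : 0 ≤ M)
    (h : ∀ x : A.domain, ‖(x : E)‖ ≤ M * ‖z • (x : E) - A x‖) : ‖resolventOp A z‖ ≤ M := by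
  obtain ⟨R, hR⟩ := hz
  rw [hR.resolventOp_eq]
  refine R.opNorm_le_bound hM fun y => ?_
  obtain ⟨hy, hRy⟩ := hR.1 y
  have := h ⟨R y, hy⟩
  rwa [hRy] at this

variable [CompleteSpace E]

/-- The lower bound of `T` passes to `S` with constant `c / 2`, so `‖S⁻¹‖ ≤ 2 / c` and a Neumann
series reaches `T`. The bound is assumed at the limit `T` only, which is what closedness needs. -/
lemma isUnit_of_norm_sub_lt {T S : E →L[ℂ] E} (hS : IsUnit S) {c : ℝ} (hc : 0 < c)
    (hT : ∀ y, c * ‖y‖ ≤ ‖T y‖) (hTS : ‖T - S‖ < c / 2) : IsUnit T := by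
  obtain ⟨S, rfl⟩ := hS
  have hlow (y : E) : c / 2 * ‖y‖ ≤ ‖(S : E →L[ℂ] E) y‖ := by
    have h1 := hT y
    have h2 : ‖(T - S : E →L[ℂ] E) y‖ ≤ c / 2 * ‖y‖ :=
      ((T - S : E →L[ℂ] E).le_opNorm y).trans (by gcongr)
    have h3 : ‖T y‖ ≤ ‖(T - S : E →L[ℂ] E) y‖ + ‖(S : E →L[ℂ] E) y‖ := by
      simpa using norm_add_le ((T - S : E →L[ℂ] E) y) ((S : E →L[ℂ] E) y)
    linarith
  have hinv : ‖((S⁻¹ : (E →L[ℂ] E)ˣ) : E →L[ℂ] E)‖ ≤ (c / 2)⁻¹ := by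
    refine ContinuousLinearMap.opNorm_le_bound _ (by positivity) fun y => ?_
    have h := hlow (((S⁻¹ : (E →L[ℂ] E)ˣ) : E →L[ℂ] E) y)
    have hy : (S : E →L[ℂ] E) (((S⁻¹ : (E →L[ℂ] E)ˣ) : E →L[ℂ] E) y) = y :=
      congrArg (fun L : E →L[ℂ] E => L y) S.mul_inv
    rw [hy] at h
    rwa [inv_mul_eq_div, le_div_iff₀ (by positivity), mul_comm]
  rcases subsingleton_or_nontrivial E with hE | hE
  · exact isUnit_of_subsingleton T
  · refine (S.ofNearby T (hTS.trans_le ?_)).isUnit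
    rw [le_inv_comm₀ (by positivity) (Units.norm_pos _)]
    exact hinv

lemma isUnit_one_add_smul (R : E →L[ℂ] E)
    (hR : ∀ s : ℝ, ∃ c : ℝ, 0 < c ∧ ∀ y, c * ‖y‖ ≤ ‖y + ((s : ℂ) * Complex.I) • R y‖) (s : ℝ) :
    IsUnit (1 + ((s : ℂ) * Complex.I) • R) := by
  let T : ℝ → E →L[ℂ] E := fun s => 1 + ((s : ℂ) * Complex.I) • R
  have hT : Continuous T := by fun_prop
  have hclopen : IsClopen {s | IsUnit (T s)} := by
    refine ⟨isClosed_of_closure_subset fun s hs => ?_, Units.isOpen.preimage hT⟩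
    obtain ⟨c, hc, hcs⟩ := hR s
    obtain ⟨t, ht, htU⟩ := mem_closure_iff_nhds.1 hs _
      (hT.continuousAt.preimage_mem_nhds (Metric.ball_mem_nhds (T s) (half_pos hc)))
    refine isUnit_of_norm_sub_lt htU hc hcs ?_
    rw [← dist_eq_norm, dist_comm]
    exact ht
  exact (Set.ext_iff.1 (hclopen.eq_univ ⟨0, by simp [T]⟩) s).2 (mem_univ s)

/-- Since `-A R = 1`, one has `(z - A) R = 1 + z R`, so for `z = is` the resolvent is `R (1 + z
R)⁻¹`. A lower bound for `is - A` bounds `R y` by `y + is R y`, hence also `y` itself. -/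
lemma imaginary_mem_resolventSet (A : E →ₗ.[ℂ] E) {R : E →L[ℂ] E} (hR : IsResolvent A 0 R)
    (hA : ∀ s : ℝ, ∃ C : ℝ, 0 < C ∧ ∀ x : A.domain,
      ‖(x : E)‖ ≤ C * ‖((s : ℂ) * Complex.I) • (x : E) - A x‖) (s : ℝ) :
    (s : ℂ) * Complex.I ∈ resolventSet A := by
  have key (z : ℂ) (y : E) : ∃ h : R y ∈ A.domain, z • R y - A ⟨R y, h⟩ = y + z • R y := by
    obtain ⟨h, hy⟩ := hR.1 y
    rw [zero_smul, zero_sub] at hy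
    exact ⟨h, by rw [sub_eq_add_neg, hy, add_comm]⟩
  obtain ⟨U, hU⟩ := isUnit_one_add_smul R (fun s => by
    obtain ⟨C, hC, H⟩ := hA s
    refine ⟨(1 + |s| * C)⁻¹, by positivity, fun y => ?_⟩
    obtain ⟨h, hy⟩ := key ((s : ℂ) * Complex.I) y
    have h1 := H ⟨R y, h⟩
    rw [hy] at h1
    have h2 : ‖y‖ ≤ ‖y + ((s : ℂ) * Complex.I) • R y‖ + |s| * ‖R y‖ := by
      have := norm_sub_le (y + ((s : ℂ) * Complex.I) • R y) (((s : ℂ) * Complex.I) • R y)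
      rwa [add_sub_cancel_right, norm_smul, norm_mul, Complex.norm_I, mul_one, Complex.norm_real,
        Real.norm_eq_abs] at this
    rw [inv_mul_le_iff₀ (by positivity)]
    have h3 : |s| * ‖R y‖ ≤ |s| * (C * ‖y + ((s : ℂ) * Complex.I) • R y‖) := by gcongr
    linarith) s
  have hUy (y : E) : (U : E →L[ℂ] E) y = y + ((s : ℂ) * Complex.I) • R y := by
    rw [hU]
    rfl
  have hUinv (y : E) : (U : E →L[ℂ] E) (((U⁻¹ : (E →L[ℂ] E)ˣ) : E →L[ℂ] E) y) = y :=
    congrArg (fun L : E →L[ℂ] E => L y) U.mul_inv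
  have hinvU (y : E) : ((U⁻¹ : (E →L[ℂ] E)ˣ) : E →L[ℂ] E) ((U : E →L[ℂ] E) y) = y :=
    congrArg (fun L : E →L[ℂ] E => L y) U.inv_mul
  refine ⟨R * ((U⁻¹ : (E →L[ℂ] E)ˣ) : E →L[ℂ] E), fun y => ?_, fun x => ?_⟩
  · obtain ⟨h, hy⟩ := key ((s : ℂ) * Complex.I) (((U⁻¹ : (E →L[ℂ] E)ˣ) : E →L[ℂ] E) y)
    exact ⟨h, hy.trans (by rw [← hUy, hUinv])⟩
  · have hx : R (-A x) = x := by
      have := hR.2 x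
      rwa [zero_smul, zero_sub] at this
    have : ((s : ℂ) * Complex.I) • (x : E) - A x = (U : E →L[ℂ] E) (-A x) := by
      rw [hUy, hx]
      abel
    rw [this, mul_apply_eq_comp, hinvU, hx]

end continuation

end

end WHW

theorem theorem3p1 :
    (∀ s : ℝ, (s : ℂ) * Complex.I ∈ WHW.resolventSet WHW.generator) ∧
    ∃ C s₀ : ℝ, 0 < C ∧ 0 < s₀ ∧ ∀ s : ℝ, s₀ ≤ |s| →
      ‖WHW.resolventOp WHW.generator ((s : ℂ) * Complex.I)‖ ≤ C * |s| ^ (1 / 2 : ℝ) := by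
  obtain ⟨R, hR⟩ := WHW.exists_isResolvent_zero WHW.generator WHW.generator_surjective
    WHW.norm_le_norm_generator
  have hmem := WHW.imaginary_mem_resolventSet WHW.generator hR WHW.exists_norm_le
  refine ⟨hmem, ?_⟩
  -- The choice `κ = 1` corresponds to the threshold `s₀ = 1`.
  obtain ⟨C, hC, H⟩ := WHW.norm_le_of_one_le_mul_sqrt le_rfl
  refine ⟨C, 1, hC, one_pos, fun s hs => ?_⟩
  rw [← Real.sqrt_eq_rpow]
  refine WHW.norm_resolventOp_le (hmem s) (by positivity) fun x => H s x ?_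
  rw [one_mul]
  exact Real.one_le_sqrt.2 hs
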